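/- Let $n,\nu\ge 1$ be integers. Let $X$ be a random complex $(n+\nu)\times n$ matrix whose squared singular values (the eigenvalues of $X^*X$), regarded as unordered points, form a polynomial ensemble with real-valued functions $f_1,\dots,f_n$ on $[0,\infty)$; that is, the integrals $\int_0^\infty x^{j-1}f_k(x)\,dx$, $1\le j,k\le n$, converge absolutely, and the squared singular values have a joint probability density of the form $$\frac1{Z_n}\,\Delta_n(x)\,\det\bigl[f_k(x_j)\bigr]_{j,k=1}^n\ \ge 0,\qquad x_1,\dots,x_n>0,\qquad \Delta_n(x)=\prod_{j<k}(x_k-x_j),$$ with a normalization constant $Z_n$. Let $v=(v_1,\dots,v_{n+\nu})^t$ be a random vector, independent of $X$, such that $\operatorname{Re}v_j$, $\operatorname{Im}v_j$ ($1\le j\le n+\nu$) are mutually independent normal random variables with mean $0$ and variance $1/2$, and let $Y=\begin{pmatrix}X & v\end{pmatrix}$ be the $(n+\nu)\times(n+1)$ matrix obtained by appending the column $v$ to $X$. Then, for every fixed $c\in(0,\infty)$, the $n+1$ squared singular values of $Y$ form, in the same sense (including the convergence of the integrals $\int_0^\infty y^{j-1}g_k(y)\,dy$, $1\le j,k\le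 n+1$), a polynomial ensemble $$\frac1{\tilde Z_{n+1}}\,\Delta_{n+1}(y)\,\det\bigl[g_k(y_j)\bigr]_{j,k=1}^{n+1},\qquad \text{all } y_j>0,$$ with functions $$g_1(y)=y^{\nu-1}e^{-y},\qquad g_{k+1}(y)=y^{\nu-1}e^{-y}\int_c^y x^{-\nu}e^{x}f_k(x)\,dx,\quad k=1,\dots,n.$$ -/

import Mathlib

open MeasureTheory ProbabilityTheory
open scoped ENNReal NNReal Matrix

noncomputable section

/-- Matrices carry the product (entrywise) σ-algebra. -/
instance matrixMeasurableSpace {m n : ℕ} : MeasurableSpace (Matrix (Fin m) (Fin n) ℂ) :=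
  inferInstanceAs (MeasurableSpace (Fin m → Fin n → ℂ))

/-- The Vandermonde product `∏_{j < k} (x_k - x_j)`. -/
def vandermondeProd {n : ℕ} (x : Fin n → ℝ) : ℝ :=
  ∏ j : Fin n, ∏ k ∈ Finset.Ioi j, (x k - x j)

/-- The function `Z⁻¹ Δ_n(x) det [f_k(x_j)]_{j,k}`. -/
def polyEnsembleDensity {n : ℕ} (Z : ℝ) (f : Fin n → ℝ → ℝ) (x : Fin n → ℝ) : ℝ :=
  Z⁻¹ * vandermondeProd x * (Matrix.of fun j k : Fin n => f k (x j)).det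

/-- The points `x ω 0, …, x ω (n-1)`, as *unordered* points, form a polynomial ensemble on the
half-line with functions `f_1, …, f_n`: the moments of order less than `n` of each `f_k` converge,
and for some constant `Z ≠ 0` the function `Z⁻¹ Δ_n(t) det [f_k(t_j)]` is non-negative for
`t_1, …, t_n > 0` and is the joint probability density of the points.
As the points carry no particular order, the last condition is expressed through the expectations
of all measurable symmetric functions of the points (`F = 1` gives the normalization).
Only the values of the `f_k` on `(0, ∞)` matter. -/
structure IsPolynomialEnsemble {Ω : Type*} [MeasurableSpace Ω] (μ : Measure Ω) {n : ℕ}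
    (x : Ω → Fin n → ℝ) (f : Fin n → ℝ → ℝ) : Prop where
  integrable_moments : ∀ j k : Fin n,
    IntegrableOn (fun t : ℝ => t ^ (j : ℕ) * f k t) (Set.Ioi 0)
  exists_density : ∃ Z : ℝ, Z ≠ 0 ∧
    (∀ t : Fin n → ℝ, (∀ j, 0 < t j) → 0 ≤ polyEnsembleDensity Z f t) ∧
    ∀ F : (Fin n → ℝ) → ℝ≥0∞, Measurable F →
      (∀ (σ : Equiv.Perm (Fin n)) (t : Fin n → ℝ), F (t ∘ σ) = F t) →
      ∫⁻ ω, F (x ω) ∂μ =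
        ∫⁻ t in {t : Fin n → ℝ | ∀ j, 0 < t j},
          F t * ENNReal.ofReal (polyEnsembleDensity Z f t)

/-- The squared singular values of an `m × n` complex matrix `A`: the eigenvalues of `Aᴴ A`,
with multiplicity. -/
def sqSingularValues {m n : ℕ} (A : Matrix (Fin m) (Fin n) ℂ) : Fin n → ℝ :=
  (Matrix.isHermitian_conjTranspose_mul_self A).eigenvalues

/-- The matrix `(A v)`, i.e. `A` with the column `v` appended on the right. -/
def appendCol {m n : ℕ} (A : Matrix (Fin m) (Fin n) ℂ) (v : Fin m → ℂ) :
    Matrix (Fin m) (Fin (n + 1)) ℂ :=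
  Matrix.of fun i => Fin.snoc (α := fun _ => ℂ) (A i) (v i)

/-- `v` is a random vector whose real and imaginary parts `Re v_j`, `Im v_j` are mutually
independent normal random variables with mean `0` and variance `1/2`. -/
structure IsComplexGaussianVector {Ω : Type*} [MeasurableSpace Ω] (μ : Measure Ω) {m : ℕ}
    (v : Ω → Fin m → ℂ) : Prop where
  measurable : Measurable v
  law_re : ∀ j, μ.map (fun ω => (v ω j).re) = gaussianReal 0 (1 / 2)
  law_im : ∀ j, μ.map (fun ω => (v ω j).im) = gaussianReal 0 (1 / 2)
  indep : iIndepFun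
    (Sum.elim (fun j ω => (v ω j).re) (fun j ω => (v ω j).im) : Fin m ⊕ Fin m → Ω → ℝ) μ

/-- The functions `g_1(y) = y^{ν-1} e^{-y}` and
`g_{k+1}(y) = y^{ν-1} e^{-y} ∫_c^y x^{-ν} e^x f_k(x) dx`, `k = 1, …, n`. -/
def columnExtensionFunctions {n : ℕ} (ν : ℕ) (c : ℝ) (f : Fin n → ℝ → ℝ) :
    Fin (n + 1) → ℝ → ℝ :=
  Fin.cons (fun y => y ^ (ν - 1) * Real.exp (-y))
    (fun k y => y ^ (ν - 1) * Real.exp (-y) * ∫ x in c..y, (x ^ ν)⁻¹ * Real.exp x * f k x)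

end

/-! The squared singular values of `Y` are, apart from zeros, the eigenvalues of `Y Yᴴ = X Xᴴ + v
vᴴ`, a rank-one update of `X Xᴴ`, whose spectrum is `x_1, …, x_n` together with `0` taken `ν` times.
Condition on `X`. By unitary invariance (`measurePreserving_mulVec_unitary`) the coordinates of `v`
in an eigenbasis are again independent standard complex normals. Their squared moduli are
exponential, and the `ν` of them over the kernel add up to a Gamma variable of shape `ν`
(`measurePreserving_cons_sum_normSq`).

With nodes `a = (0, x_1, …, x_n)` and these variables `r_j`, the determinant of the update gives `∏
(1 - y_i / t) = ∏ (1 - a_j / t) * (1 - ∑ r_j / (t - a_j))`. Thus `r` is the vector of residues of a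
partial fraction expansion. For sorted, distinct nodes, `y ↦ r` is a bijection from the `y`
interlacing with `a` onto the positive orthant (`injOn_interlacingResidue`,
`surjOn_interlacingResidue`), with absolute Jacobian `Δ(y) / Δ(a)` (`abs_det_interlacingJacobian`).
Since `∑ r = ∑ y - ∑ x` and `r_0 = ∏ y / ∏ x`, the Gamma densities become an explicit kernel on
interlacing pairs (`lintegral_sqSingularValues_appendCol`).

Multiplying by the density of `x` cancels `Δ(x)`. For fixed `y` interlacing means that `x` lies in
the box `∏ (y_j, y_{j+1})`, so the remaining determinant integrates entry by entry to `det
∫_{y_j}^{y_{j+1}} x^{-ν} e^x f_k`. This is the determinant of size `n + 1` with a column of ones and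
entries `∫_c^{y_j}` after subtracting successive rows (`det_one_column_eq_det_sub`); in particular
`c` is immaterial.

No measurable labelling of the eigenvalues is used: a symmetric function of points depends only on
the polynomial vanishing at them, and `measurable_symmetric_comp` gets measurability from that
polynomial. -/

/-! ### Unordered points and the polynomials that determine them -/

theorem exists_equiv_of_map_univ_eq {ι κ α : Type*} [Fintype ι] [Fintype κ] {x : ι → α}
    {y : κ → α} (h : Multiset.map x Finset.univ.val = Multiset.map y Finset.univ.val) :
    ∃ e : ι ≃ κ, ∀ i, x i = y (e i) := by
  classical
  have hc : ∀ c, Fintype.card {i // x i = c} = Fintype.card {j // y j = c} := fun c => by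
    have := congrArg (Multiset.count c) h
    rw [Multiset.count_map, Multiset.count_map] at this
    rw [Fintype.card_subtype, Fintype.card_subtype]
    simpa only [Finset.card_def, Finset.filter_val, eq_comm (a := c)] using this
  refine ⟨(Equiv.sigmaFiberEquiv x).symm.trans
    ((Equiv.sigmaCongrRight fun c => Fintype.equivOfCardEq (hc c)).trans
      (Equiv.sigmaFiberEquiv y)), fun i => ?_⟩
  exact ((Fintype.equivOfCardEq (hc (x i))) ⟨i, rfl⟩).2.symm

theorem exists_equiv_of_prod_sub_eq {ι κ : Type*} [Fintype ι] [Fintype κ] {x : ι → ℝ}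
    {y : κ → ℝ} {s : Set ℝ} (hs : s.Infinite)
    (h : ∀ t ∈ s, ∏ i, (t - x i) = ∏ j, (t - y j)) :
    ∃ e : ι ≃ κ, ∀ i, x i = y (e i) := by
  apply exists_equiv_of_map_univ_eq
  have hp : (∏ i, (Polynomial.X - Polynomial.C (x i))) =
      ∏ j, (Polynomial.X - Polynomial.C (y j)) := by
    refine Polynomial.eq_of_infinite_eval_eq _ _ (hs.mono fun t ht => ?_)
    simpa [Polynomial.eval_prod] using h t ht
  have hr := congrArg Polynomial.roots hp
  rw [Polynomial.roots_prod _ _ (Finset.prod_ne_zero_iff.2 fun i _ => Polynomial.X_sub_C_ne_zero _),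
    Polynomial.roots_prod _ _
      (Finset.prod_ne_zero_iff.2 fun i _ => Polynomial.X_sub_C_ne_zero _)] at hr
  simpa using hr

/-- A point at `0` contributes the factor `1`, so these products do not see zeros; `hcard` restores
them. This blindness to zeros is what allows Gram matrices of different sizes to be compared. -/
theorem exists_equiv_of_prod_one_sub_div_eq {ι κ : Type*} [Fintype ι] [Fintype κ] {x : ι → ℝ}
    {y : κ → ℝ} (hcard : Fintype.card ι = Fintype.card κ)
    (h : ∀ t < 0, ∏ i, (1 - x i / t) = ∏ j, (1 - y j / t)) :
    ∃ e : ι ≃ κ, ∀ i, x i = y (e i) := by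
  refine exists_equiv_of_prod_sub_eq (Set.Iio_infinite (0 : ℝ)) fun t (ht : t < 0) => ?_
  have key : ∀ a : ℝ, t - a = t * (1 - a / t) := fun a => by
    rw [mul_sub, mul_div_cancel₀ _ ht.ne, mul_one]
  simp only [key, Finset.prod_mul_distrib, Finset.prod_const, Finset.card_univ, hcard, h t ht]

/-- A symmetric function takes equal values at tuples with the same reciprocal polynomial. -/
theorem symmetric_apply_eq_of_prod_eq {n : ℕ} {β : Type*} {F : (Fin n → ℝ) → β}
    (hF : ∀ (σ : Equiv.Perm (Fin n)) (t : Fin n → ℝ), F (t ∘ σ) = F t) {x y : Fin n → ℝ}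
    (h : ∀ t < 0, ∏ i, (1 - x i / t) = ∏ j, (1 - y j / t)) : F x = F y := by
  obtain ⟨e, he⟩ := exists_equiv_of_prod_one_sub_div_eq rfl h
  rw [show x = y ∘ e from funext he, hF]

/-- A measurable symmetric function of real points is a measurable function of
the polynomial having these points as roots. -/
theorem measurable_symmetric_comp {n : ℕ} {α β : Type*} [MeasurableSpace α] [MeasurableSpace β]
    {F : (Fin n → ℝ) → β} (hFm : Measurable F)
    (hF : ∀ (σ : Equiv.Perm (Fin n)) (t : Fin n → ℝ), F (t ∘ σ) = F t) {g : α → Fin n → ℝ}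
    (hg : ∀ t < 0, Measurable fun a => ∏ i, (1 - g a i / t)) :
    Measurable fun a => F (g a) := by
  have hM : MeasurableSet {x : Fin n → ℝ | Monotone x} := by
    have : {x : Fin n → ℝ | Monotone x} = ⋂ (i : Fin n) (j : Fin n) (_ : i ≤ j), {x | x i ≤ x j} := by
      ext x; simp [Monotone]
    rw [this]
    exact MeasurableSet.iInter fun i => MeasurableSet.iInter fun j => MeasurableSet.iInter fun _ =>
      measurableSet_le (measurable_pi_apply i) (measurable_pi_apply j)
  have : StandardBorelSpace {x : Fin n → ℝ | Monotone x} := hM.standardBorel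
  -- Countably many sample points `-1, -2, …` already determine the polynomial, hence the sorted
  -- tuple, and keep the target standard Borel.
  let e : {x : Fin n → ℝ | Monotone x} → ℕ → ℝ :=
    fun x k => ∏ i, (1 - x.1 i / (-(k + 1 : ℝ)))
  have he : Measurable e := by
    refine measurable_pi_iff.2 fun k => Finset.measurable_fun_prod _ fun i _ => ?_
    exact ((((measurable_pi_apply i).comp measurable_subtype_coe).div_const _).const_sub _)
  have hinj : Function.Injective e := by
    intro x y hxy
    have : ∃ σ : Equiv.Perm (Fin n), ∀ i, x.1 i = y.1 (σ i) := by
      refine exists_equiv_of_prod_sub_eq (s := Set.range fun k : ℕ => (-(k + 1 : ℝ)))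
        (Set.infinite_range_of_injective fun a b hab => by simpa using hab) ?_
      rintro _ ⟨k, rfl⟩
      have hk : (-(k + 1 : ℝ)) ≠ 0 := by have : (0:ℝ) < k + 1 := by positivity
                                         linarith
      have key : ∀ a : ℝ, (-(k + 1 : ℝ)) - a = (-(k + 1 : ℝ)) * (1 - a / (-(k + 1 : ℝ))) :=
        fun a => by rw [mul_sub, mul_div_cancel₀ _ hk, mul_one]
      have := congrFun hxy k
      simp only [e] at this
      simp only [key, Finset.prod_mul_distrib, this]
    obtain ⟨σ, hσ⟩ := this
    have hxs : x.1 = y.1 ∘ σ := funext hσ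
    have h1 : Monotone (y.1 ∘ σ) := hxs ▸ x.2
    have h2 : Monotone (y.1 ∘ (1 : Equiv.Perm (Fin n))) := y.2
    exact Subtype.ext (hxs.trans (Tuple.unique_monotone h1 h2))
  -- Lusin–Souslin: an injective measurable map between standard Borel spaces is a measurable
  -- embedding, so measurability of the sorted tuple can be tested after `e`.
  have hemb : MeasurableEmbedding e := he.measurableEmbedding hinj
  let s : α → {x : Fin n → ℝ | Monotone x} :=
    fun a => ⟨g a ∘ Tuple.sort (g a), Tuple.monotone_sort (g a)⟩
  have hs : Measurable s := by
    rw [← hemb.measurable_comp_iff]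
    refine measurable_pi_iff.2 fun k => ?_
    have h0 : (-(k + 1 : ℝ)) < 0 := by have : (0:ℝ) < k + 1 := by positivity
                                       linarith
    convert! hg _ h0 using 2 with a
    exact Equiv.prod_comp (Tuple.sort (g a)) fun i => 1 - g a i / (-(k + 1 : ℝ))
  have : (fun a => F (g a)) = fun a => F (s a).1 := funext fun a => (hF _ _).symm
  rw [this]
  exact hFm.comp (measurable_subtype_coe.comp hs)

/-! ### Complex Gaussian vectors and unitary invariance -/

/-- The standard complex normal distribution. -/
noncomputable def complexGaussian : Measure ℂ :=
  ((gaussianReal 0 (1 / 2)).prod (gaussianReal 0 (1 / 2))).map Complex.measurableEquivRealProd.symm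

instance isProbabilityMeasure_complexGaussian : IsProbabilityMeasure complexGaussian :=
  Measure.isProbabilityMeasure_map Complex.measurableEquivRealProd.symm.measurable.aemeasurable

theorem charFunDual_complexGaussian (L : StrongDual ℝ ℂ) :
    charFunDual complexGaussian L =
      Complex.exp (-((L 1 ^ 2 + L Complex.I ^ 2 : ℝ) : ℂ) / 4) := by
  have hL : ∀ p : ℝ × ℝ, L (Complex.measurableEquivRealProd.symm p) = L 1 * p.1 + L Complex.I * p.2 := by
    intro p
    have : Complex.measurableEquivRealProd.symm p = p.1 • (1 : ℂ) + p.2 • Complex.I := by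
      apply Complex.ext <;> simp [Complex.measurableEquivRealProd]
    rw [this, map_add, map_smul, map_smul]
    simp [mul_comm]
  rw [charFunDual_apply, complexGaussian, integral_map_equiv]
  simp_rw [hL, Complex.ofReal_add, add_mul, Complex.exp_add]
  rw [integral_prod_mul (fun x : ℝ => Complex.exp (((L 1 * x : ℝ) : ℂ) * Complex.I))
    (fun x : ℝ => Complex.exp (((L Complex.I * x : ℝ) : ℂ) * Complex.I))]
  simp_rw [Complex.ofReal_mul, ← charFun_apply_real]
  rw [charFun_gaussianReal, charFun_gaussianReal, ← Complex.exp_add]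
  congr 1
  push_cast
  ring

/-- Independence is given for the `2m` real coordinates; the product measure is regrouped along
`ℝ^(m ⊕ m) ≃ ℝ^m × ℝ^m ≃ (ℝ × ℝ)^m ≃ ℂ^m`. -/
theorem IsComplexGaussianVector.map_eq_pi {Ω : Type*} [MeasurableSpace Ω] {μ : Measure Ω}
    [IsProbabilityMeasure μ] {m : ℕ} {v : Ω → Fin m → ℂ} (hv : IsComplexGaussianVector μ v) :
    μ.map v = Measure.pi fun _ => complexGaussian := by
  have hm : ∀ i : Fin m ⊕ Fin m, Measurable
      (Sum.elim (fun j ω => (v ω j).re) (fun j ω => (v ω j).im) i : Ω → ℝ) := by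
    rintro (j | j)
    · exact Complex.measurable_re.comp ((measurable_pi_apply j).comp hv.measurable)
    · exact Complex.measurable_im.comp ((measurable_pi_apply j).comp hv.measurable)
  have h1 := (iIndepFun_iff_map_fun_eq_pi_map fun i => (hm i).aemeasurable).1 hv.indep
  have h2 : (fun i : Fin m ⊕ Fin m => μ.map
      (Sum.elim (fun j ω => (v ω j).re) (fun j ω => (v ω j).im) i : Ω → ℝ)) =
      fun _ => gaussianReal 0 (1 / 2) := by
    funext i
    rcases i with j | j
    · exact hv.law_re j
    · exact hv.law_im j
  rw [h2] at h1
  have hp : MeasurePreserving (fun ω (i : Fin m ⊕ Fin m) =>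
      (Sum.elim (fun j ω => (v ω j).re) (fun j ω => (v ω j).im) i : Ω → ℝ) ω) μ
      (Measure.pi fun _ => gaussianReal 0 (1 / 2)) := ⟨measurable_pi_iff.2 hm, h1⟩
  have hA := (measurePreserving_sumPiEquivProdPi
    (fun _ : Fin m ⊕ Fin m => gaussianReal 0 (1 / 2))).comp hp
  have hB := ((measurePreserving_arrowProdEquivProdArrow ℝ ℝ (Fin m)
    (fun _ => gaussianReal 0 (1 / 2)) (fun _ => gaussianReal 0 (1 / 2))).symm _).comp hA
  have hC := (measurePreserving_pi (fun _ : Fin m => (gaussianReal 0 (1 / 2)).prod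
    (gaussianReal 0 (1 / 2))) (fun _ => complexGaussian)
    (f := fun _ => Complex.measurableEquivRealProd.symm)
    (fun _ => ⟨Complex.measurableEquivRealProd.symm.measurable, rfl⟩)).comp hB
  rw [← hC.map_eq]
  rfl

theorem sum_normSq_vecMul_unitary {ι : Type*} [Fintype ι] [DecidableEq ι] {U : Matrix ι ι ℂ}
    (hU : U * Uᴴ = 1) (c : ι → ℂ) :
    ∑ i, Complex.normSq ((c ᵥ* U) i) = ∑ i, Complex.normSq (c i) := by
  have h : ∀ d : ι → ℂ, ((∑ i, Complex.normSq (d i) : ℝ) : ℂ) = d ⬝ᵥ star d := fun d => by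
    simp [dotProduct, Complex.mul_conj]
  apply Complex.ofReal_injective
  rw [h, h, Matrix.star_vecMul, Matrix.dotProduct_mulVec, Matrix.vecMul_vecMul, hU,
    Matrix.vecMul_one]

/-- A vector of independent standard complex normal variables is unitarily invariant. -/
theorem measurePreserving_mulVec_unitary {ι : Type*} [Fintype ι] [DecidableEq ι]
    {U : Matrix ι ι ℂ} (hU : U * Uᴴ = 1) :
    MeasurePreserving (fun v : ι → ℂ => U *ᵥ v) (Measure.pi fun _ => complexGaussian)
      (Measure.pi fun _ => complexGaussian) := by
  let T : (ι → ℂ) →L[ℝ] (ι → ℂ) :=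
    LinearMap.toContinuousLinearMap ((Matrix.mulVecLin U).restrictScalars ℝ)
  have hT : (fun v : ι → ℂ => U *ᵥ v) = T := rfl
  refine ⟨by rw [hT]; exact T.continuous.measurable, ?_⟩
  rw [hT]
  refine Measure.ext_of_charFunDual ?_
  ext L
  rw [charFunDual_map, charFunDual_pi, charFunDual_pi]
  simp_rw [charFunDual_complexGaussian, ← Complex.exp_sum, ← Finset.sum_div,
    Finset.sum_neg_distrib, ← Complex.ofReal_sum]
  congr 4
  -- `c` represents `L` as `v ↦ Re (c · v)`. The characteristic function depends only on `∑ |c_j|²`,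
  -- and composing with `U` replaces `c` by `c ᵥ* U`, of the same norm.
  let c : ι → ℂ := fun j => ⟨L (Pi.single j 1), - L (Pi.single j Complex.I)⟩
  have hL : ∀ v, L v = (c ⬝ᵥ v).re := by
    intro v
    rw [← L.sum_comp_single]
    simp only [dotProduct, Complex.re_sum]
    refine Finset.sum_congr rfl fun j _ => ?_
    have : v j = (v j).re • (1 : ℂ) + (v j).im • Complex.I := by
      apply Complex.ext <;> simp
    conv_lhs => rw [this, map_add, map_smul, map_smul]
    simp [c, mul_comm]
  have e1 : ∀ d : ι → ℂ, ∀ j, (d ⬝ᵥ Pi.single j 1).re ^ 2 + (d ⬝ᵥ Pi.single j Complex.I).re ^ 2 =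
      Complex.normSq (d j) := by
    intro d j
    rw [dotProduct_single, dotProduct_single, Complex.normSq_apply]
    simp
    ring
  have hLT : ∀ v, L (T v) = ((c ᵥ* U) ⬝ᵥ v).re := by
    intro v
    rw [hL, ← Matrix.dotProduct_mulVec]
    rfl
  calc _ = ∑ j, Complex.normSq ((c ᵥ* U) j) := by
        refine Finset.sum_congr rfl fun j _ => ?_
        rw [← e1]
        simp [hLT]
    _ = ∑ j, Complex.normSq (c j) := sum_normSq_vecMul_unitary hU c
    _ = _ := by
        refine Finset.sum_congr rfl fun j _ => ?_
        rw [← e1]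
        simp [hL]

/-! ### Gamma laws of squared moduli -/

/-- The density of the Gamma distribution of shape `k + 1` and rate `1` on the half-line. -/
noncomputable def erlangDensity (k : ℕ) (t : ℝ) : ℝ≥0∞ :=
  ENNReal.ofReal (t ^ k / k.factorial * Real.exp (-t))

/-- The Gamma distribution of shape `k + 1` and rate `1`. -/
noncomputable def erlangMeasure (k : ℕ) : Measure ℝ :=
  (volume.restrict (Set.Ioi 0)).withDensity (erlangDensity k)

@[fun_prop]
theorem measurable_erlangDensity (k : ℕ) : Measurable (erlangDensity k) := by
  unfold erlangDensity
  fun_prop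

instance sigmaFinite_erlangMeasure (k : ℕ) : SigmaFinite (erlangMeasure k) :=
  SigmaFinite.withDensity_ofReal _

theorem lintegral_erlangMeasure (k : ℕ) {g : ℝ → ℝ≥0∞} (hg : Measurable g) :
    ∫⁻ t, g t ∂erlangMeasure k = ∫⁻ t in Set.Ioi 0, erlangDensity k t * g t := by
  rw [erlangMeasure, lintegral_withDensity_eq_lintegral_mul _ (measurable_erlangDensity k) hg]
  rfl

/-- Polar coordinates followed by the substitution `s = r ^ 2`; the angle integrates to `1` against
`(2π)⁻¹`. -/
theorem map_normSq_complexGaussian : complexGaussian.map Complex.normSq = erlangMeasure 0 := by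
  have hns : Measurable Complex.normSq := Complex.continuous_normSq.measurable
  refine Measure.ext_of_lintegral _ fun g hg => ?_
  rw [lintegral_map hg hns, complexGaussian, lintegral_map_equiv, lintegral_erlangMeasure _ hg]
  have hv : (1 / 2 : ℝ≥0) ≠ 0 := by norm_num
  rw [gaussianReal_of_var_ne_zero _ hv, prod_withDensity (measurable_gaussianPDF _ _)
    (measurable_gaussianPDF _ _), lintegral_withDensity_eq_lintegral_mul _ (by fun_prop)
    (g := fun p => g (Complex.normSq (Complex.measurableEquivRealProd.symm p)))
    (hg.comp (hns.comp Complex.measurableEquivRealProd.symm.measurable))]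
  have hden : ∀ p : ℝ × ℝ, gaussianPDF 0 (1 / 2) p.1 * gaussianPDF 0 (1 / 2) p.2 =
      ENNReal.ofReal (Real.pi⁻¹ * Real.exp (-(p.1 ^ 2 + p.2 ^ 2))) := by
    intro p
    rw [gaussianPDF, gaussianPDF, ← ENNReal.ofReal_mul (gaussianPDFReal_nonneg _ _ _)]
    congr 1
    simp only [gaussianPDFReal]
    have h1 : (2 * Real.pi * ((1 / 2 : ℝ≥0) : ℝ)) = Real.pi := by push_cast; ring
    have h2 : (2 * ((1 / 2 : ℝ≥0) : ℝ)) = 1 := by push_cast; ring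
    rw [h1, h2]
    have h3 : (√Real.pi)⁻¹ * (√Real.pi)⁻¹ = Real.pi⁻¹ := by
      rw [← mul_inv, Real.mul_self_sqrt Real.pi_pos.le]
    rw [← h3, neg_add, Real.exp_add]
    simp
    ring
  change ∫⁻ p : ℝ × ℝ, gaussianPDF 0 (1 / 2) p.1 * gaussianPDF 0 (1 / 2) p.2 *
    g (Complex.normSq (Complex.measurableEquivRealProd.symm p)) = _
  simp_rw [hden]
  rw [← lintegral_comp_polarCoord_symm]
  have hpol : ∀ p ∈ polarCoord.target, ENNReal.ofReal p.1 •
      (ENNReal.ofReal (Real.pi⁻¹ * Real.exp (-((polarCoord.symm p).1 ^ 2 + (polarCoord.symm p).2 ^ 2)))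
        * g (Complex.normSq (Complex.measurableEquivRealProd.symm (polarCoord.symm p)))) =
      ENNReal.ofReal (2 * p.1) * (erlangDensity 0 (p.1 ^ 2) * g (p.1 ^ 2)) *
        ENNReal.ofReal ((2 * Real.pi)⁻¹) := by
    rintro ⟨r, θ⟩ hp
    have hr : 0 < r := hp.1
    have hsq : (polarCoord.symm (r, θ)).1 ^ 2 + (polarCoord.symm (r, θ)).2 ^ 2 = r ^ 2 := by
      simp only [polarCoord_symm_apply]
      linear_combination r ^ 2 * Real.cos_sq_add_sin_sq θ
    have hn : Complex.normSq (Complex.measurableEquivRealProd.symm (polarCoord.symm (r, θ))) =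
        r ^ 2 := by
      rw [Complex.normSq_apply, ← hsq]
      simp [Complex.measurableEquivRealProd]
      ring
    rw [hsq, hn, smul_eq_mul, erlangDensity, ← mul_assoc, ← mul_assoc, mul_right_comm _ (g _),
      ← ENNReal.ofReal_mul hr.le, ← ENNReal.ofReal_mul (by positivity),
      ← ENNReal.ofReal_mul (by positivity)]
    congr 2
    simp
    field_simp
  rw [setLIntegral_congr_fun (polarCoord.open_target.measurableSet) hpol, polarCoord_target,
    Measure.volume_eq_prod, ← Measure.prod_restrict,
    lintegral_prod_mul (f := fun r : ℝ => ENNReal.ofReal (2 * r) *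
      (erlangDensity 0 (r ^ 2) * g (r ^ 2))) (g := fun _ => ENNReal.ofReal ((2 * Real.pi)⁻¹))
      (by fun_prop) (by fun_prop), lintegral_const, Measure.restrict_apply_univ, Real.volume_Ioo,
    ← ENNReal.ofReal_mul (by positivity),
    show (2 * Real.pi)⁻¹ * (Real.pi - -Real.pi) = 1 by field_simp; ring, ENNReal.ofReal_one,
    mul_one]
  have himg : (fun r : ℝ => r ^ 2) '' Set.Ioi 0 = Set.Ioi 0 := by
    ext t
    constructor
    · rintro ⟨r, hr, rfl⟩
      exact pow_pos (show 0 < r from hr) 2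
    · intro ht
      exact ⟨√t, Real.sqrt_pos.2 ht, Real.sq_sqrt (le_of_lt ht)⟩
  have hinj : Set.InjOn (fun r : ℝ => r ^ 2) (Set.Ioi 0) := fun a ha b hb hab =>
    (pow_left_inj₀ (le_of_lt ha) (le_of_lt hb) two_ne_zero).1 hab
  conv_rhs => rw [← himg, lintegral_image_eq_lintegral_abs_deriv_mul measurableSet_Ioi
    (fun r _ => (hasDerivAt_pow 2 r).hasDerivWithinAt) hinj]
  refine setLIntegral_congr_fun measurableSet_Ioi fun r (hr : 0 < r) => ?_
  simp only [Nat.cast_ofNat, Nat.add_one_sub_one, pow_one]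
  rw [abs_of_pos (by positivity)]

/-- In the convolution the exponentials combine to `exp (-u)` with `u = s + t`, leaving `∫_0^u t^k /
k! dt = u^(k+1) / (k+1)!`. -/
theorem map_add_erlangMeasure (k : ℕ) :
    ((erlangMeasure 0).prod (erlangMeasure k)).map (fun p => p.1 + p.2) = erlangMeasure (k + 1) := by
  refine Measure.ext_of_lintegral _ fun g hg => ?_
  rw [lintegral_map hg (by fun_prop), lintegral_prod_symm _ (by fun_prop),
    lintegral_erlangMeasure k (g := fun t => ∫⁻ s, g (s + t) ∂erlangMeasure 0)
      (Measurable.lintegral_prod_left' (f := fun p : ℝ × ℝ => g (p.1 + p.2)) (by fun_prop)),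
    lintegral_erlangMeasure _ hg]
  have h1 : ∀ t ∈ Set.Ioi (0 : ℝ), erlangDensity k t * ∫⁻ s, g (s + t) ∂erlangMeasure 0 =
      ∫⁻ u in Set.Ioi 0, (Set.Iio u).indicator
        (fun t => ENNReal.ofReal (t ^ k / k.factorial)) t * (ENNReal.ofReal (Real.exp (-u)) * g u) := by
    intro t (ht : 0 < t)
    rw [lintegral_erlangMeasure _ (by fun_prop), ← lintegral_indicator measurableSet_Ioi,
      ← lintegral_sub_right_eq_self _ t, ← lintegral_indicator measurableSet_Ioi,
      ← lintegral_const_mul' (erlangDensity k t) _ ENNReal.ofReal_ne_top]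
    refine lintegral_congr fun u => ?_
    by_cases hu : t < u
    · have hu0 : 0 < u := ht.trans hu
      rw [Set.indicator_of_mem (show u - t ∈ Set.Ioi 0 from sub_pos.2 hu),
        Set.indicator_of_mem (show u ∈ Set.Ioi 0 from hu0),
        Set.indicator_of_mem (show t ∈ Set.Iio u from hu), sub_add_cancel, ← mul_assoc, ← mul_assoc]
      congr 1
      rw [erlangDensity, erlangDensity, ← ENNReal.ofReal_mul (by positivity),
        ← ENNReal.ofReal_mul (by positivity)]
      congr 1
      rw [show -u = -t + -(u - t) by ring, Real.exp_add]
      simp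
      ring
    · rw [Set.indicator_of_notMem (show u - t ∉ Set.Ioi 0 from fun h => hu (sub_pos.1 h)),
        mul_zero]
      simp only [Set.indicator_apply, Set.mem_Iio, hu, if_false, zero_mul, ite_self]
  rw [setLIntegral_congr_fun measurableSet_Ioi h1, lintegral_lintegral_swap]
  · refine setLIntegral_congr_fun measurableSet_Ioi fun u (hu : 0 < u) => ?_
    rw [lintegral_mul_const _ (Measurable.indicator (by fun_prop) measurableSet_Iio),
      lintegral_indicator measurableSet_Iio, Measure.restrict_restrict measurableSet_Iio,
      Set.Iio_inter_Ioi, Measure.restrict_congr_set Ioo_ae_eq_Ioc,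
      ← ofReal_integral_eq_lintegral_ofReal, ← intervalIntegral.integral_of_le hu.le,
      intervalIntegral.integral_div, integral_pow, ← mul_assoc, erlangDensity,
      ← ENNReal.ofReal_mul' (Real.exp_pos _).le]
    · congr 3
      rw [Nat.factorial_succ]
      push_cast
      field_simp
      simp
    · exact (Continuous.integrableOn_Icc (by fun_prop)).mono_set Set.Ioc_subset_Icc_self
    · refine (ae_restrict_iff' measurableSet_Ioc).2 (ae_of_all _ fun t ht => ?_)
      have := ht.1
      simp only [Pi.zero_apply]
      positivity
  · refine Measurable.aemeasurable ?_
    refine Measurable.mul ?_ (by fun_prop)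
    have : (fun a : ℝ × ℝ => (Set.Iio a.2).indicator
        (fun t => ENNReal.ofReal (t ^ k / k.factorial)) a.1) = {p : ℝ × ℝ | p.1 < p.2}.indicator
        fun p => ENNReal.ofReal (p.1 ^ k / k.factorial) := by
      ext p
      simp [Set.indicator_apply]
    rw [this]
    exact Measurable.indicator (by fun_prop) (measurableSet_lt measurable_fst measurable_snd)

theorem map_sum_erlangMeasure (k : ℕ) :
    (Measure.pi fun _ : Fin (k + 1) => erlangMeasure 0).map (fun x => ∑ i, x i) =
      erlangMeasure k := by
  induction k with
  | zero =>
    have h := (measurePreserving_funUnique (erlangMeasure 0) (Fin 1)).map_eq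
    convert! h using 2
    ext x
    simp [MeasurableEquiv.funUnique]
  | succ k ih =>
    have h1 := measurePreserving_piFinSuccAbove (fun _ : Fin (k + 2) => erlangMeasure 0) 0
    have h2 : MeasurePreserving (fun x : Fin (k + 1) → ℝ => ∑ i, x i)
        (Measure.pi fun _ => erlangMeasure 0) (erlangMeasure k) := ⟨by fun_prop, ih⟩
    have h3 := ((MeasurePreserving.id (erlangMeasure 0)).prod h2).comp h1
    have h4 : MeasurePreserving (fun p : ℝ × ℝ => p.1 + p.2)
        ((erlangMeasure 0).prod (erlangMeasure k)) (erlangMeasure (k + 1)) :=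
      ⟨by fun_prop, map_add_erlangMeasure k⟩
    rw [← (h4.comp h3).map_eq]
    congr 1
    ext x
    simp [Fin.sum_univ_succ, MeasurableEquiv.piFinSuccAbove]
    rfl

theorem lintegral_fin_prod_eq_prod {α : Type*} [MeasurableSpace α] {n : ℕ} (μ : Fin n → Measure α)
    [∀ i, SigmaFinite (μ i)] {f : Fin n → α → ℝ≥0∞} (hf : ∀ i, Measurable (f i)) :
    ∫⁻ x, ∏ i, f i (x i) ∂Measure.pi μ = ∏ i, ∫⁻ t, f i t ∂μ i := by
  induction n with
  | zero => simp
  | succ n ih =>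
    rw [← ((measurePreserving_piFinSuccAbove μ 0).symm _).lintegral_comp
      (f := fun x : Fin (n + 1) → α => ∏ i, f i (x i)) (Finset.measurable_fun_prod _ fun i _ => (hf i).comp (measurable_pi_apply i))]
    simp only [Fin.prod_univ_succ]
    rw [← ih (fun i => μ i.succ) (fun i => hf i.succ), ← lintegral_prod_mul (hf 0).aemeasurable
      (Finset.measurable_fun_prod _
        fun i _ => (hf i.succ).comp (measurable_pi_apply i)).aemeasurable]
    rfl

theorem pi_withDensity_fin {α : Type*} [MeasurableSpace α] {n : ℕ} (μ : Fin n → Measure α)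
    [∀ i, SigmaFinite (μ i)] {f : Fin n → α → ℝ≥0∞} (hf : ∀ i, Measurable (f i))
    [∀ i, SigmaFinite ((μ i).withDensity (f i))] :
    Measure.pi (fun i => (μ i).withDensity (f i)) =
      (Measure.pi μ).withDensity fun x => ∏ i, f i (x i) := by
  refine Measure.pi_eq fun s hs => ?_
  rw [withDensity_apply _ (MeasurableSet.univ_pi hs), Measure.restrict_pi_pi,
    lintegral_fin_prod_eq_prod _ hf]
  exact Finset.prod_congr rfl fun i _ => (withDensity_apply _ (hs i)).symm

/-- The law of the squared moduli of independent standard complex normal variables, the last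
`k + 1` of which are added up. -/
theorem measurePreserving_cons_sum_normSq (n k : ℕ) :
    MeasurePreserving (fun w : Fin n ⊕ Fin (k + 1) → ℂ =>
      (Fin.cons (∑ i, Complex.normSq (w (Sum.inr i))) fun j => Complex.normSq (w (Sum.inl j)) :
        Fin (n + 1) → ℝ))
      (Measure.pi fun _ => complexGaussian)
      (Measure.pi fun i : Fin (n + 1) => erlangMeasure ((Fin.cons k fun _ => 0 : Fin (n + 1) → ℕ) i)) := by
  have hns : MeasurePreserving Complex.normSq complexGaussian (erlangMeasure 0) :=
    ⟨Complex.continuous_normSq.measurable, map_normSq_complexGaussian⟩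
  have h1 := measurePreserving_sumPiEquivProdPi (fun _ : Fin n ⊕ Fin (k + 1) => complexGaussian)
  have h2 := measurePreserving_pi (fun _ : Fin n => complexGaussian) (fun _ => erlangMeasure 0)
    (fun _ => hns)
  have h3 := measurePreserving_pi (fun _ : Fin (k + 1) => complexGaussian)
    (fun _ => erlangMeasure 0) (fun _ => hns)
  have h4 : MeasurePreserving (fun x : Fin (k + 1) → ℝ => ∑ i, x i)
      (Measure.pi fun _ => erlangMeasure 0) (erlangMeasure k) :=
    ⟨by fun_prop, map_sum_erlangMeasure k⟩
  have h5 := (h2.prod (h4.comp h3)).comp h1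
  have h6 := Measure.measurePreserving_swap.comp h5
  have h7 := (measurePreserving_piFinSuccAbove
    (fun i : Fin (n + 1) => erlangMeasure ((Fin.cons k fun _ => 0 : Fin (n + 1) → ℕ) i)) 0).symm _
  convert h7.comp h6 using 1
  ext w i
  refine Fin.cases ?_ (fun j => ?_) i <;> rfl

theorem lintegral_pi_erlangMeasure {n : ℕ} (κ : Fin n → ℕ) {G : (Fin n → ℝ) → ℝ≥0∞}
    (hG : Measurable G) :
    ∫⁻ r, G r ∂Measure.pi (fun i => erlangMeasure (κ i)) =
      ∫⁻ r in {r : Fin n → ℝ | ∀ i, 0 < r i}, (∏ i, erlangDensity (κ i) (r i)) * G r := by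
  have : ∀ i, SigmaFinite ((volume.restrict (Set.Ioi (0 : ℝ))).withDensity (erlangDensity (κ i))) :=
    fun i => sigmaFinite_erlangMeasure (κ i)
  have hset : {r : Fin n → ℝ | ∀ i, 0 < r i} = Set.univ.pi fun _ => Set.Ioi 0 := by
    ext; simp
  unfold erlangMeasure
  rw [pi_withDensity_fin _ (fun i => measurable_erlangDensity (κ i)),
    lintegral_withDensity_eq_lintegral_mul _ (by fun_prop) hG, hset, volume_pi,
    Measure.restrict_pi_pi]
  rfl

/-! ### Rank-one updates and the characteristic polynomial -/

section Hermitian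
variable {ι : Type*} [Fintype ι] [DecidableEq ι] {M : Matrix ι ι ℂ}

theorem Matrix.IsHermitian.exists_unitary_eq (hM : M.IsHermitian) :
    ∃ U : Matrix ι ι ℂ, U * Uᴴ = 1 ∧ Uᴴ * U = 1 ∧
      M = Uᴴ * Matrix.diagonal (fun i => (hM.eigenvalues i : ℂ)) * U := by
  refine ⟨(hM.eigenvectorUnitary : Matrix ι ι ℂ)ᴴ, ?_, ?_, ?_⟩
  · rw [Matrix.conjTranspose_conjTranspose]
    exact Unitary.coe_star_mul_self _
  · rw [Matrix.conjTranspose_conjTranspose]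
    exact Unitary.coe_mul_star_self _
  · rw [Matrix.conjTranspose_conjTranspose]
    exact hM.spectral_theorem

theorem det_one_sub_smul_conj {U N : Matrix ι ι ℂ} (hU' : Uᴴ * U = 1) (c : ℂ) :
    (1 - c • (Uᴴ * N * U)).det = (1 - c • N).det := by
  have : 1 - c • (Uᴴ * N * U) = Uᴴ * (1 - c • N) * U := by
    rw [mul_sub, sub_mul, mul_one, hU', Matrix.mul_smul, Matrix.smul_mul]
  rw [this, Matrix.det_mul_right_comm, hU', one_mul]

theorem Matrix.IsHermitian.det_one_sub_inv_smul (hM : M.IsHermitian) (t : ℝ) :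
    (1 - (t : ℂ)⁻¹ • M).det = ((∏ i, (1 - hM.eigenvalues i / t) : ℝ) : ℂ) := by
  obtain ⟨U, hU, hU', h⟩ := hM.exists_unitary_eq
  conv_lhs => rw [h]
  rw [det_one_sub_smul_conj hU', ← Matrix.diagonal_smul, ← Matrix.diagonal_one,
    Matrix.diagonal_sub, Matrix.det_diagonal]
  push_cast
  refine Finset.prod_congr rfl fun i _ => ?_
  simp
  ring

/-- The matrix determinant lemma; `ht` and `hd` make the diagonal part invertible. -/
theorem det_one_sub_smul_diagonal_add_vecMulVec (d w : ι → ℂ) (t : ℂ) (ht : t ≠ 0)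
    (hd : ∀ i, t - d i ≠ 0) :
    (1 - t⁻¹ • (Matrix.diagonal d + Matrix.vecMulVec w (star w))).det =
      (∏ i, (1 - d i / t)) * (1 - ∑ i, (Complex.normSq (w i) : ℂ) / (t - d i)) := by
  have h1 : ∀ i, 1 - d i / t ≠ 0 := fun i h => hd i (by
    rw [sub_eq_zero, eq_comm, div_eq_one_iff_eq ht] at h
    rw [h, sub_self])
  have h : 1 - t⁻¹ • (Matrix.diagonal d + Matrix.vecMulVec w (star w)) =
      Matrix.diagonal (fun i => 1 - d i / t) +
        Matrix.replicateCol Unit (-t⁻¹ • w) * Matrix.replicateRow Unit (star w) := by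
    ext i j
    by_cases hij : i = j
    · subst hij
      simp [Matrix.vecMulVec_apply, Matrix.mul_apply]
      ring
    · simp [Matrix.vecMulVec_apply, Matrix.mul_apply, hij, mul_assoc]
  have hdet : (Matrix.diagonal fun i => 1 - d i / t).det = ∏ i, (1 - d i / t) :=
    Matrix.det_diagonal
  rw [h, Matrix.det_add_replicateCol_mul_replicateRow, hdet]
  · congr 1
    rw [Matrix.det_unique]
    have hinv : (Matrix.diagonal fun i => 1 - d i / t)⁻¹ =
        Matrix.diagonal fun i => (1 - d i / t)⁻¹ := by
      refine Matrix.inv_eq_right_inv ?_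
      rw [Matrix.diagonal_mul_diagonal, ← Matrix.diagonal_one]
      congr 1
      exact funext fun i => mul_inv_cancel₀ (h1 i)
    rw [hinv]
    rw [sub_eq_add_neg, ← Finset.sum_neg_distrib, Matrix.add_apply, Matrix.one_apply_eq,
      Matrix.mul_apply]
    congr 1
    refine Finset.sum_congr rfl fun i _ => ?_
    have h2 : t * (1 - d i / t) = t - d i := by rw [mul_sub, mul_one, mul_div_cancel₀ _ ht]
    rw [Matrix.mul_diagonal, Matrix.replicateRow_apply, Matrix.replicateCol_apply, ← h2,
      Complex.normSq_eq_conj_mul_self]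
    simp only [Pi.star_apply, RCLike.star_def, Pi.smul_apply, smul_eq_mul]
    have := h1 i
    field_simp
  · rw [hdet]
    exact (Finset.prod_ne_zero_iff.2 fun i _ => h1 i).isUnit

end Hermitian

theorem appendCol_mul_conjTranspose {m n : ℕ} (A : Matrix (Fin m) (Fin n) ℂ) (v : Fin m → ℂ) :
    appendCol A v * (appendCol A v)ᴴ = A * Aᴴ + Matrix.vecMulVec v (star v) := by
  ext i j
  simp [appendCol, Matrix.mul_apply, Fin.sum_univ_castSucc, Matrix.vecMulVec_apply]

/-- Sylvester's identity `det (1 - BA) = det (1 - AB)` passes from `Aᴴ A` to `A Aᴴ`, where appending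
a column is a rank-one update. -/
theorem prod_one_sub_sqSingularValues {m n : ℕ} (A : Matrix (Fin m) (Fin n) ℂ) (t : ℝ) :
    ((∏ i, (1 - sqSingularValues A i / t) : ℝ) : ℂ) = (1 - (t : ℂ)⁻¹ • (A * Aᴴ)).det := by
  unfold sqSingularValues
  rw [← Matrix.IsHermitian.det_one_sub_inv_smul, ← Matrix.smul_mul, ← Matrix.mul_smul,
    Matrix.det_one_sub_mul_comm]

theorem exists_equiv_eigenvalues_mul_conjTranspose {n ν : ℕ}
    (A : Matrix (Fin (n + ν)) (Fin n) ℂ) :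
    ∃ e : Fin (n + ν) ≃ Fin n ⊕ Fin ν, ∀ i,
      (Matrix.isHermitian_mul_conjTranspose_self A).eigenvalues i =
        Sum.elim (sqSingularValues A) (fun _ => 0) (e i) := by
  refine exists_equiv_of_prod_one_sub_div_eq (by simp) fun t _ => ?_
  apply Complex.ofReal_injective
  rw [← Matrix.IsHermitian.det_one_sub_inv_smul, ← prod_one_sub_sqSingularValues,
    Fintype.prod_sum_type]
  simp

open scoped ComplexOrder in
/-- The squared singular values of `(A v)` in terms of those of `A` and of the squared moduli
of the coordinates of `v` in a suitable orthonormal basis. -/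
theorem exists_unitary_prod_one_sub_sqSingularValues_appendCol {n ν : ℕ}
    (A : Matrix (Fin (n + ν)) (Fin n) ℂ) (σ : Equiv.Perm (Fin n)) :
    ∃ (U : Matrix (Fin (n + ν)) (Fin (n + ν)) ℂ) (e : Fin (n + ν) ≃ Fin n ⊕ Fin ν),
      U * Uᴴ = 1 ∧ ∀ v : Fin (n + ν) → ℂ, ∀ t < (0 : ℝ),
        ∏ i, (1 - sqSingularValues (appendCol A v) i / t) =
          (∏ j, (1 - (Fin.cons 0 (sqSingularValues A ∘ σ) : Fin (n + 1) → ℝ) j / t)) *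
            (1 - ∑ j, (Fin.cons (∑ k, Complex.normSq ((U *ᵥ v) (e.symm (Sum.inr k))))
              (fun j => Complex.normSq ((U *ᵥ v) (e.symm (Sum.inl j)))) : Fin (n + 1) → ℝ) j /
              (t - (Fin.cons 0 (sqSingularValues A ∘ σ) : Fin (n + 1) → ℝ) j)) := by
  have hM := Matrix.isHermitian_mul_conjTranspose_self A
  obtain ⟨U, hU, hU', h⟩ := hM.exists_unitary_eq
  obtain ⟨e, he⟩ := exists_equiv_eigenvalues_mul_conjTranspose A
  -- Twisting by `σ⁻¹` labels the eigenvector coordinates in the same order as the relabelled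
  -- singular values `sqSingularValues A ∘ σ`.
  refine ⟨U, e.trans (Equiv.sumCongr σ.symm (Equiv.refl _)), hU, fun v t ht => ?_⟩
  have hlam : ∀ i, 0 ≤ hM.eigenvalues i :=
    fun i => (Matrix.posSemidef_self_mul_conjTranspose A).eigenvalues_nonneg i
  apply Complex.ofReal_injective
  have hrank : A * Aᴴ + Matrix.vecMulVec v (star v) =
      Uᴴ * (Matrix.diagonal (fun i => (hM.eigenvalues i : ℂ)) +
        Matrix.vecMulVec (U *ᵥ v) (star (U *ᵥ v))) * U := by
    rw [mul_add, add_mul, ← h, Matrix.mul_vecMulVec, Matrix.vecMulVec_mul, Matrix.star_mulVec,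
      Matrix.vecMul_vecMul, Matrix.mulVec_mulVec, hU', Matrix.one_mulVec, Matrix.vecMul_one]
  rw [prod_one_sub_sqSingularValues, appendCol_mul_conjTranspose, hrank,
    det_one_sub_smul_conj hU', det_one_sub_smul_diagonal_add_vecMulVec _ _ _
      (by exact_mod_cast ht.ne) fun i => by
        have : t - hM.eigenvalues i ≠ 0 := by linarith [hlam i] |> ne_of_lt
        exact_mod_cast this]
  have hp : ∏ i, (1 - hM.eigenvalues i / t) = ∏ i, (1 - sqSingularValues A i / t) := by
    apply Complex.ofReal_injective
    rw [← Matrix.IsHermitian.det_one_sub_inv_smul, ← prod_one_sub_sqSingularValues]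
  have hs : ∀ w : Fin (n + ν) → ℂ, ∑ i, Complex.normSq (w i) / (t - hM.eigenvalues i) =
      (∑ k, Complex.normSq (w (e.symm (Sum.inr k)))) / t +
        ∑ j, Complex.normSq (w (e.symm (Sum.inl (σ j)))) / (t - sqSingularValues A (σ j)) := by
    intro w
    rw [← Equiv.sum_comp e.symm, Fintype.sum_sum_type, add_comm, Finset.sum_div,
      Equiv.sum_comp σ (fun j => Complex.normSq (w (e.symm (Sum.inl j))) /
        (t - sqSingularValues A j))]
    simp [he]
  simp only [Fin.sum_univ_succ, Fin.prod_univ_succ, Fin.cons_zero, Fin.cons_succ, Function.comp,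
    Equiv.prod_comp σ (fun j => 1 - sqSingularValues A j / t)]
  have := hs (U *ᵥ v)
  simp only [Equiv.symm_trans_apply, Equiv.sumCongr_symm, Equiv.sumCongr_apply, Sum.map_inr,
    Sum.map_inl, Equiv.symm_symm, Equiv.refl_symm, Equiv.refl_apply]
  rw [zero_div, sub_zero, one_mul, sub_zero, ← this, ← hp]
  push_cast
  rfl

/-! ### Interlacing points and residue coordinates -/

section Interlacing
variable {N : ℕ}

/-- The points `y` with `a_1 < y_1 < a_2 < y_2 < ⋯ < a_N < y_N`. -/
def interlacingSet (a : Fin N → ℝ) : Set (Fin N → ℝ) :=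
  {y | (∀ i, a i < y i) ∧ ∀ i j, i < j → y i < a j}

/-- The residues `r_j` in `∏ (t - y_i) / ∏ (t - a_i) = 1 - ∑ r_j / (t - a_j)`. -/
noncomputable def interlacingResidue (a y : Fin N → ℝ) (j : Fin N) : ℝ :=
  -(∏ i, (a j - y i)) / ∏ i ∈ Finset.univ.erase j, (a j - a i)

theorem strictMono_of_mem_interlacingSet {a y : Fin N → ℝ} (h : y ∈ interlacingSet a) :
    StrictMono y := fun i j hij => (h.2 i j hij).trans (h.1 j)

theorem prod_erase_sub_ne_zero {a : Fin N → ℝ} (ha : Function.Injective a) (j : Fin N) :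
    ∏ i ∈ Finset.univ.erase j, (a j - a i) ≠ 0 :=
  Finset.prod_ne_zero_iff.2 fun _ hi => sub_ne_zero.2 fun h => Finset.ne_of_mem_erase hi (ha h).symm

/-- For `i ≠ j` no node lies between `a i` and `y i`, so `a j - y i` and `a j - a i` have the same
sign; the one unpaired factor is `y j - a j`. -/
theorem interlacingResidue_pos {a y : Fin N → ℝ} (h : y ∈ interlacingSet a) (j : Fin N) :
    0 < interlacingResidue a y j := by
  have ha : StrictMono a := fun i j hij => (h.1 i).trans (h.2 i j hij)
  have : interlacingResidue a y j =
      (y j - a j) * ∏ i ∈ Finset.univ.erase j, ((a j - y i) / (a j - a i)) := by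
    rw [interlacingResidue, ← Finset.mul_prod_erase _ _ (Finset.mem_univ j),
      Finset.prod_div_distrib]
    ring
  rw [this]
  refine mul_pos (sub_pos.2 (h.1 j)) (Finset.prod_pos fun i hi => ?_)
  rcases lt_or_gt_of_ne (Finset.ne_of_mem_erase hi) with hij | hij
  · exact div_pos (sub_pos.2 (h.2 i j hij)) (sub_pos.2 (ha hij))
  · exact div_pos_of_neg_of_neg (sub_neg.2 ((ha hij).trans (h.1 i))) (sub_neg.2 (ha hij))

theorem degree_nodal_sub_nodal_lt (a y : Fin N → ℝ) :
    (Lagrange.nodal Finset.univ a - Lagrange.nodal Finset.univ y).degree < N := by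
  have := Polynomial.degree_sub_lt_left (p := Lagrange.nodal Finset.univ a)
    (q := Lagrange.nodal Finset.univ y) (by simp [Lagrange.degree_nodal]) Lagrange.nodal_ne_zero
    (by rw [Lagrange.nodal_monic.leadingCoeff, Lagrange.nodal_monic.leadingCoeff])
  simpa [Lagrange.degree_nodal] using this

theorem eval_nodal_sub_nodal (a y : Fin N → ℝ) (j : Fin N) :
    (Lagrange.nodal Finset.univ a - Lagrange.nodal Finset.univ y).eval (a j) =
      -∏ i, (a j - y i) := by
  rw [Polynomial.eval_sub, Lagrange.eval_nodal_at_node (Finset.mem_univ j), Lagrange.eval_nodal,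
    zero_sub]

/-- Partial fractions: `∏ (t - a_i) - ∏ (t - y_i)` has degree below `N`, since the leading terms
cancel, so Lagrange interpolation at the nodes recovers it. -/
theorem prod_one_sub_div_eq_interlacingResidue {a : Fin N → ℝ} (ha : Function.Injective a)
    (y : Fin N → ℝ) {t : ℝ} (ht : t ≠ 0) (hta : ∀ j, t ≠ a j) :
    ∏ i, (1 - y i / t) =
      (∏ j, (1 - a j / t)) * (1 - ∑ j, interlacingResidue a y j / (t - a j)) := by
  have hQ := Lagrange.eq_interpolate (s := Finset.univ) (v := a) ha.injOn
    (f := Lagrange.nodal Finset.univ a - Lagrange.nodal Finset.univ y)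
    (by simpa using degree_nodal_sub_nodal_lt a y)
  have hQt := congrArg (Polynomial.eval t) hQ
  rw [Lagrange.eval_interpolate_not_at_node _ fun i _ => hta i, Polynomial.eval_sub,
    Lagrange.eval_nodal, Lagrange.eval_nodal] at hQt
  have key : ∀ b : ℝ, 1 - b / t = (t - b) / t := fun b => by rw [sub_div, div_self ht]
  simp only [key, Finset.prod_div_distrib]
  have hsum : ∑ j, interlacingResidue a y j / (t - a j) =
      ∑ i, Lagrange.nodalWeight Finset.univ a i * (t - a i)⁻¹ *
        (Lagrange.nodal Finset.univ a - Lagrange.nodal Finset.univ y).eval (a i) := by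
    refine Finset.sum_congr rfl fun j _ => ?_
    rw [eval_nodal_sub_nodal, interlacingResidue, Lagrange.nodalWeight, Finset.prod_inv_distrib]
    ring
  rw [hsum, div_mul_eq_mul_div, mul_sub, mul_one, ← hQt]
  ring

/-- Both sides are the coefficient of `t^(N-1)` in `∏ (t - a_i) - ∏ (t - y_i)`, read off by
interpolation and by Vieta. -/
theorem sum_interlacingResidue {a : Fin N → ℝ} (ha : Function.Injective a) (y : Fin N → ℝ) :
    ∑ j, interlacingResidue a y j = ∑ i, y i - ∑ i, a i := by
  rcases Nat.eq_zero_or_pos N with rfl | hN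
  · simp
  have h := Lagrange.coeff_eq_sum (s := Finset.univ) (v := a) ha.injOn
    (P := Lagrange.nodal Finset.univ a - Lagrange.nodal Finset.univ y)
    (by simpa using degree_nodal_sub_nodal_lt a y)
  have hc : 0 < (Finset.univ : Finset (Fin N)).card := by simpa using hN
  rw [Polynomial.coeff_sub, Lagrange.nodal_eq, Lagrange.nodal_eq,
    Polynomial.prod_X_sub_C_coeff_card_pred _ _ hc,
    Polynomial.prod_X_sub_C_coeff_card_pred _ _ hc, ← Lagrange.nodal_eq, ← Lagrange.nodal_eq] at h
  simp_rw [eval_nodal_sub_nodal] at h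
  simp only [interlacingResidue]
  rw [← h]
  ring

theorem nodal_eq_of_interlacingResidue_eq {a y z : Fin N → ℝ} (ha : Function.Injective a)
    (h : interlacingResidue a y = interlacingResidue a z) :
    Lagrange.nodal Finset.univ y = Lagrange.nodal Finset.univ z := by
  refine Polynomial.eq_of_degree_sub_lt_of_eval_index_eq Finset.univ ha.injOn
    (by simpa using degree_nodal_sub_nodal_lt y z) fun j _ => ?_
  have := congrFun h j
  simp only [interlacingResidue] at this
  rw [div_left_inj' (prod_erase_sub_ne_zero ha j), neg_inj] at this
  rw [Lagrange.eval_nodal, Lagrange.eval_nodal, this]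

theorem injOn_interlacingResidue {a : Fin N → ℝ} (ha : Function.Injective a) :
    Set.InjOn (interlacingResidue a) (interlacingSet a) := by
  intro y hy z hz h
  have hn := nodal_eq_of_interlacingResidue_eq ha h
  obtain ⟨σ, hσ⟩ := exists_equiv_of_prod_sub_eq (x := y) (y := z) Set.infinite_univ fun t _ => by
    rw [← Lagrange.eval_nodal, ← Lagrange.eval_nodal, hn]
  have hys : y = z ∘ σ := funext hσ
  have h1 : Monotone (z ∘ σ) := hys ▸ (strictMono_of_mem_interlacingSet hy).monotone
  have h2 : Monotone (z ∘ (1 : Equiv.Perm (Fin N))) := (strictMono_of_mem_interlacingSet hz).monotone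
  exact hys.trans (Tuple.unique_monotone h1 h2)

theorem exists_root_mem_Ioo (P : Polynomial ℝ) {u v : ℝ} (huv : u < v)
    (h : P.eval u * P.eval v < 0) : ∃ y ∈ Set.Ioo u v, P.eval y = 0 := by
  rcases mul_neg_iff.1 h with ⟨h1, h2⟩ | ⟨h1, h2⟩
  · exact intermediate_value_Ioo' huv.le P.continuous.continuousOn ⟨h2, h1⟩
  · exact intermediate_value_Ioo huv.le P.continuous.continuousOn ⟨h1, h2⟩

/-- The derivative of `∏ (t - a_i)` changes sign between consecutive nodes: every other node lies on
the same side of both. -/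
theorem prod_erase_sub_mul_neg {n : ℕ} {a : Fin (n + 1) → ℝ} (ha : StrictMono a) (k : Fin n) :
    (∏ i ∈ Finset.univ.erase k.castSucc, (a k.castSucc - a i)) *
      (∏ i ∈ Finset.univ.erase k.succ, (a k.succ - a i)) < 0 := by
  have hk : k.castSucc < k.succ := Fin.castSucc_lt_succ
  have h1 : k.succ ∈ Finset.univ.erase k.castSucc := by simp [hk.ne']
  have h2 : k.castSucc ∈ Finset.univ.erase k.succ := by simp [hk.ne]
  rw [← Finset.mul_prod_erase _ _ h1, ← Finset.mul_prod_erase _ _ h2, mul_mul_mul_comm,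
    Finset.erase_right_comm, ← Finset.prod_mul_distrib]
  refine mul_neg_of_neg_of_pos
    (mul_neg_of_neg_of_pos (sub_neg.2 (ha hk)) (sub_pos.2 (ha hk))) (Finset.prod_pos fun i hi => ?_)
  simp only [Finset.mem_erase, Finset.mem_univ, and_true] at hi
  rcases lt_or_gt_of_ne hi.2 with h | h
  · have h' : i < k.castSucc := lt_of_le_of_ne (Fin.le_castSucc_iff.2 h) hi.1
    exact mul_pos (sub_pos.2 (ha h')) (sub_pos.2 (ha h))
  · exact mul_pos_of_neg_of_neg (sub_neg.2 (ha (hk.trans h))) (sub_neg.2 (ha h))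

/-- The candidate polynomial `P` is monic with values at the nodes prescribed by `r`. Positivity of
`r` makes these values alternate in sign, which puts a root in each gap and one beyond the last
node; by degree these are all the roots. -/
theorem surjOn_interlacingResidue {n : ℕ} {a : Fin (n + 1) → ℝ} (ha : StrictMono a) :
    Set.SurjOn (interlacingResidue a) (interlacingSet a) {r | ∀ j, 0 < r j} := by
  intro r hr
  let q : Polynomial ℝ := Lagrange.interpolate Finset.univ a
    fun j => r j * ∏ i ∈ Finset.univ.erase j, (a j - a i)
  let P : Polynomial ℝ := Lagrange.nodal Finset.univ a - q
  have hq : q.degree < (Lagrange.nodal Finset.univ a).degree := by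
    rw [Lagrange.degree_nodal]
    exact Lagrange.degree_interpolate_lt _ ha.injective.injOn
  have hPa : ∀ j, P.eval (a j) = -(r j * ∏ i ∈ Finset.univ.erase j, (a j - a i)) := fun j => by
    rw [Polynomial.eval_sub, Lagrange.eval_nodal_at_node (Finset.mem_univ j),
      Lagrange.eval_interpolate_at_node _ ha.injective.injOn (Finset.mem_univ j), zero_sub]
  have hPdeg : P.degree = (n + 1 : ℕ) := by
    rw [Polynomial.degree_sub_eq_left_of_degree_lt hq, Lagrange.degree_nodal]
    simp
  have hPlc : P.leadingCoeff = 1 := by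
    rw [Polynomial.leadingCoeff_sub_of_degree_lt hq, Lagrange.nodal_monic.leadingCoeff]
  have hroot : ∀ i, ∃ y, a i < y ∧ (∀ j, i < j → y < a j) ∧ P.eval y = 0 := by
    intro i
    refine Fin.lastCases ?_ (fun k => ?_) i
    -- To the right of the last node: `P` is negative there and tends to `+∞`.
    · have htop := P.tendsto_atTop_of_leadingCoeff_nonneg
        (by rw [hPdeg]; exact_mod_cast Nat.succ_pos n) (by rw [hPlc]; exact zero_le_one)
      obtain ⟨T, hT, hTa⟩ := ((htop.eventually_gt_atTop 0).and
        (Filter.eventually_gt_atTop (a (Fin.last n)))).exists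
      have hneg : P.eval (a (Fin.last n)) < 0 := by
        rw [hPa, neg_lt_zero]
        refine mul_pos (hr _) (Finset.prod_pos fun i hi => sub_pos.2 (ha ?_))
        exact lt_of_le_of_ne (Fin.le_last i) (Finset.ne_of_mem_erase hi)
      obtain ⟨y, hy, hy0⟩ := exists_root_mem_Ioo P hTa (mul_neg_of_neg_of_pos hneg hT)
      exact ⟨y, hy.1, fun j hj => absurd hj (Fin.le_last j).not_gt, hy0⟩
    · have hneg : P.eval (a k.castSucc) * P.eval (a k.succ) < 0 := by
        rw [hPa, hPa, neg_mul_neg, mul_mul_mul_comm]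
        exact mul_neg_of_pos_of_neg (mul_pos (hr _) (hr _)) (prod_erase_sub_mul_neg ha k)
      obtain ⟨y, hy, hy0⟩ := exists_root_mem_Ioo P (ha Fin.castSucc_lt_succ) hneg
      exact ⟨y, hy.1, fun j hj => hy.2.trans_le (ha.monotone (Fin.castSucc_lt_iff_succ_le.1 hj)), hy0⟩
  choose y hay hya hy0 using hroot
  have hy : y ∈ interlacingSet a := ⟨hay, hya⟩
  have hPy : P = Lagrange.nodal Finset.univ y := by
    refine Polynomial.eq_of_degree_le_of_eval_index_eq Finset.univ
      (strictMono_of_mem_interlacingSet hy).injective.injOn ?_ ?_ ?_ fun i _ => ?_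
    · rw [hPdeg]; simp
    · rw [hPdeg, Lagrange.degree_nodal]; simp
    · rw [hPlc, Lagrange.nodal_monic.leadingCoeff]
    · rw [hy0, Lagrange.eval_nodal_at_node (Finset.mem_univ i)]
  refine ⟨y, hy, funext fun j => ?_⟩
  rw [interlacingResidue, ← Lagrange.eval_nodal, ← hPy, hPa, neg_neg,
    mul_div_cancel_right₀ _ (prod_erase_sub_ne_zero ha.injective j)]

theorem image_interlacingResidue {n : ℕ} {a : Fin (n + 1) → ℝ} (ha : StrictMono a) :
    interlacingResidue a '' interlacingSet a = {r | ∀ j, 0 < r j} :=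
  Set.Subset.antisymm (Set.image_subset_iff.2 fun _ hy j => interlacingResidue_pos hy j)
    (surjOn_interlacingResidue ha)

theorem measurableSet_interlacingSet (a : Fin N → ℝ) : MeasurableSet (interlacingSet a) := by
  refine MeasurableSet.inter ?_ ?_
  · exact measurableSet_setOfPred.2 (by fun_prop)
  · exact measurableSet_setOfPred.2 (by fun_prop)

/-- The Jacobian matrix of `interlacingResidue a`. -/
noncomputable def interlacingJacobian (a y : Fin N → ℝ) : Matrix (Fin N) (Fin N) ℝ :=
  Matrix.of fun j i => (∏ i ∈ Finset.univ.erase j, (a j - a i))⁻¹ *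
    ∏ k ∈ Finset.univ.erase i, (a j - y k)

theorem hasFDerivAt_interlacingResidue (a y : Fin N → ℝ) :
    HasFDerivAt (interlacingResidue a)
      (LinearMap.toContinuousLinearMap (Matrix.toLin' (interlacingJacobian a y))) y := by
  rw [hasFDerivAt_pi']
  intro j
  have h : HasFDerivAt (fun y : Fin N → ℝ => ∏ i, (a j - y i))
      (∑ i, (∏ k ∈ Finset.univ.erase i, (a j - y k)) •
        -(ContinuousLinearMap.proj i : (Fin N → ℝ) →L[ℝ] ℝ)) y :=
    HasFDerivAt.finsetProd fun i _ => (hasFDerivAt_apply i y).const_sub (a j)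
  have h2 := h.neg.mul_const (∏ i ∈ Finset.univ.erase j, (a j - a i))⁻¹
  convert! h2 using 1
  ext u
  simp [interlacingJacobian, Matrix.mulVec, dotProduct, Finset.mul_sum, mul_assoc]

theorem vandermondeProd_eq_det (x : Fin N → ℝ) :
    vandermondeProd x = (Matrix.vandermonde x).det := (Matrix.det_vandermonde x).symm

theorem vandermondeProd_pos {x : Fin N → ℝ} (hx : StrictMono x) : 0 < vandermondeProd x :=
  Finset.prod_pos fun _ _ => Finset.prod_pos fun _ hk => sub_pos.2 (hx (Finset.mem_Ioi.1 hk))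

theorem abs_prod_prod_erase_sub (x : Fin N → ℝ) :
    |∏ j, ∏ i ∈ Finset.univ.erase j, (x j - x i)| = |vandermondeProd x| ^ 2 := by
  have h : ∀ j : Fin N, Finset.univ.erase j = (Finset.Ioi j).disjUnion (Finset.Iio j)
      (Finset.disjoint_left.2 fun i hi hi' => lt_asymm (Finset.mem_Ioi.1 hi) (Finset.mem_Iio.1 hi')) := by
    intro j
    ext i
    simpa [or_comm] using ne_iff_lt_or_gt (a := i) (b := j)
  simp only [vandermondeProd, h, Finset.prod_disjUnion, Finset.prod_mul_distrib, sq, abs_mul,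
    Finset.abs_prod]
  congr 1
  · exact Finset.prod_congr rfl fun _ _ => Finset.prod_congr rfl fun _ _ => abs_sub_comm _ _
  · exact Finset.prod_comm' (by simp)

/-- Let `p_i = ∏_{k ≠ i} (t - y_k)` have coefficient matrix `C`. Evaluation at `a` gives
`vandermonde a * C`, while evaluation at `y` is diagonal with determinant `±Δ(y)²`; hence `|det C| =
Δ(y)`. The row denominators contribute `Δ(a)⁻²`. -/
theorem abs_det_interlacingJacobian {a y : Fin N → ℝ} (ha : StrictMono a) (hy : StrictMono y) :
    |(interlacingJacobian a y).det| = vandermondeProd y / vandermondeProd a := by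
  let p : Fin N → Polynomial ℝ := fun i => Lagrange.nodal (Finset.univ.erase i) y
  have hp : ∀ i, (p i).natDegree < N := fun i => by
    rw [Lagrange.natDegree_nodal, Finset.card_erase_of_mem (Finset.mem_univ i), Finset.card_univ,
      Fintype.card_fin]
    exact Nat.sub_lt i.pos one_pos
  let C : Matrix (Fin N) (Fin N) ℝ := Matrix.of fun k i => (p i).coeff k
  have hev : ∀ x : Fin N → ℝ, Matrix.of (fun j i => (p i).eval (x j)) = Matrix.vandermonde x * C := by
    intro x
    ext j i
    rw [Matrix.of_apply, Polynomial.eval_eq_sum_range' (hp i), Finset.sum_range, Matrix.mul_apply]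
    exact Finset.sum_congr rfl fun k _ => mul_comm _ _
  have hM : interlacingJacobian a y =
      Matrix.diagonal (fun j => (∏ i ∈ Finset.univ.erase j, (a j - a i))⁻¹) *
        (Matrix.vandermonde a * C) := by
    rw [← hev]
    ext j i
    rw [Matrix.diagonal_mul, Matrix.of_apply, Lagrange.eval_nodal]
    rfl
  have hD : Matrix.vandermonde y * C =
      Matrix.diagonal fun j => ∏ i ∈ Finset.univ.erase j, (y j - y i) := by
    rw [← hev]
    ext j i
    rw [Matrix.of_apply, Lagrange.eval_nodal, Matrix.diagonal_apply]
    split_ifs with hji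
    · rw [hji]
    · exact Finset.prod_eq_zero (Finset.mem_erase.2 ⟨hji, Finset.mem_univ j⟩) (sub_self _)
  have hVy := vandermondeProd_pos hy
  have hVa := vandermondeProd_pos ha
  have hC : |C.det| = vandermondeProd y := by
    have := congrArg (fun M => |Matrix.det M|) hD
    simp only [Matrix.det_mul, Matrix.det_diagonal, ← vandermondeProd_eq_det, abs_mul,
      abs_prod_prod_erase_sub, abs_of_pos hVy, sq] at this
    exact mul_left_cancel₀ hVy.ne' this
  rw [hM, Matrix.det_mul, Matrix.det_mul, Matrix.det_diagonal, Finset.prod_inv_distrib, abs_mul,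
    abs_inv, abs_prod_prod_erase_sub, abs_mul, hC, ← vandermondeProd_eq_det, abs_of_pos hVa]
  field_simp

theorem lintegral_pos_eq_lintegral_interlacingSet {n : ℕ} {a : Fin (n + 1) → ℝ} (ha : StrictMono a)
    (G : (Fin (n + 1) → ℝ) → ℝ≥0∞) :
    ∫⁻ r in {r : Fin (n + 1) → ℝ | ∀ j, 0 < r j}, G r =
      ∫⁻ y in interlacingSet a, ENNReal.ofReal (vandermondeProd y / vandermondeProd a) *
        G (interlacingResidue a y) := by
  rw [← image_interlacingResidue ha, lintegral_image_eq_lintegral_abs_det_fderiv_mul volume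
    (measurableSet_interlacingSet a)
    (fun y _ => (hasFDerivAt_interlacingResidue a y).hasFDerivWithinAt)
    (injOn_interlacingResidue ha.injective)]
  refine setLIntegral_congr_fun (measurableSet_interlacingSet a) fun y hy => ?_
  rw [← abs_det_interlacingJacobian ha (strictMono_of_mem_interlacingSet hy)]
  congr 3
  exact LinearMap.det_toLin' _

end Interlacing

/-! ### The conditional law given the original matrix -/

theorem measurePreserving_pi_comp_equiv {ι κ α : Type*} [Fintype ι] [Fintype κ] [MeasurableSpace α]
    (μ : Measure α) [SigmaFinite μ] (e : ι ≃ κ) :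
    MeasurePreserving (fun w : κ → α => fun i => w (e i)) (Measure.pi fun _ => μ)
      (Measure.pi fun _ => μ) := by
  have h := measurePreserving_piCongrLeft (fun _ : ι => μ) e.symm
  convert! h using 1
  ext w i
  obtain ⟨j, rfl⟩ := e.symm.surjective i
  rw [MeasurableEquiv.coe_piCongrLeft, Equiv.piCongrLeft_apply_apply, Equiv.apply_symm_apply]

theorem vandermondeProd_cons_zero {n : ℕ} (x : Fin n → ℝ) :
    vandermondeProd (Fin.cons 0 x : Fin (n + 1) → ℝ) = (∏ j, x j) * vandermondeProd x := by
  simp [vandermondeProd, Fin.prod_univ_succ, Fin.prod_Ioi_succ]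

theorem strictMono_cons_zero {n : ℕ} {x : Fin n → ℝ} (hx : StrictMono x) (hpos : ∀ j, 0 < x j) :
    StrictMono (Fin.cons 0 x : Fin (n + 1) → ℝ) := by
  intro i j
  refine Fin.cases (fun h => ?_) (fun j h => ?_) j
  · exact absurd h (Fin.not_lt_zero i)
  · revert h
    refine Fin.cases (fun _ => ?_) (fun i h => ?_) i
    · simpa using hpos j
    · simpa using hx (Fin.succ_lt_succ_iff.1 h)

theorem interlacingResidue_cons_zero_apply_zero {n : ℕ} (x : Fin n → ℝ) (y : Fin (n + 1) → ℝ) :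
    interlacingResidue (Fin.cons 0 x) y 0 = (∏ i, y i) / ∏ j, x j := by
  have h : (Finset.univ.erase (0 : Fin (n + 1))) = Finset.univ.map (Fin.succEmb n) := by
    ext i
    refine Fin.cases ?_ (fun j => ?_) i <;> simp
  simp only [interlacingResidue, h, Finset.prod_map, Fin.coe_succEmb, Fin.cons_zero, Fin.cons_succ,
    zero_sub, Finset.prod_neg, Finset.card_map, Finset.card_univ, Fintype.card_fin]
  rw [pow_succ, mul_neg_one, neg_mul, neg_neg, mul_div_mul_left _ _ (by simp)]

/-- The conditional density of the ordered squared singular values `y` of `(A v)` given the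
squared singular values `x` of `A`, up to the interlacing condition. -/
noncomputable def columnKernel {n : ℕ} (k : ℕ) (x : Fin n → ℝ) (y : Fin (n + 1) → ℝ) : ℝ :=
  vandermondeProd y * (∏ i, y i ^ k * Real.exp (-y i)) *
    ((vandermondeProd x)⁻¹ * ∏ j, (x j ^ (k + 1))⁻¹ * Real.exp (x j)) / k.factorial

/-- Only the residue at the node `0` has a Gamma density with a power, which gives `(∏ y / ∏ x)^k`.
The last factor `(∏ x)⁻¹` comes from `Δ(0, x) = ∏ x * Δ(x)`, and the exponents add up through
`sum_interlacingResidue`. -/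
theorem vandermondeProd_mul_prod_erlangDensity {n k : ℕ} {x : Fin n → ℝ} (hx : StrictMono x)
    (hpos : ∀ j, 0 < x j) {y : Fin (n + 1) → ℝ} (hy : y ∈ interlacingSet (Fin.cons 0 x)) :
    ENNReal.ofReal (vandermondeProd y / vandermondeProd (Fin.cons 0 x : Fin (n + 1) → ℝ)) *
      ∏ i, erlangDensity ((Fin.cons k fun _ => 0 : Fin (n + 1) → ℕ) i)
        (interlacingResidue (Fin.cons 0 x) y i) = ENNReal.ofReal (columnKernel k x y) := by
  have ha := strictMono_cons_zero hx hpos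
  have hr := interlacingResidue_pos hy
  have hxp : 0 < ∏ j, x j := Finset.prod_pos fun j _ => hpos j
  simp only [erlangDensity]
  rw [← ENNReal.ofReal_prod_of_nonneg fun i _ => by have := hr i; positivity,
    ← ENNReal.ofReal_mul (div_nonneg (vandermondeProd_pos (strictMono_of_mem_interlacingSet hy)).le
      (vandermondeProd_pos ha).le)]
  congr 1
  have hexp : ∏ i, Real.exp (-interlacingResidue (Fin.cons 0 x) y i) =
      (∏ i, Real.exp (-y i)) * ∏ j, Real.exp (x j) := by
    rw [← Real.exp_sum, ← Real.exp_sum, ← Real.exp_sum, ← Real.exp_add, Finset.sum_neg_distrib,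
      sum_interlacingResidue ha.injective, Fin.sum_univ_succ (Fin.cons 0 x : Fin (n + 1) → ℝ),
      Finset.sum_neg_distrib]
    simp only [Fin.cons_zero, Fin.cons_succ]
    congr 1
    ring
  rw [Finset.prod_mul_distrib, hexp, Fin.prod_univ_succ]
  simp only [Fin.cons_zero, Fin.cons_succ, pow_zero, Nat.factorial_zero, Nat.cast_one, div_one,
    Finset.prod_const_one, mul_one]
  rw [interlacingResidue_cons_zero_apply_zero, vandermondeProd_cons_zero, columnKernel,
    Finset.prod_mul_distrib, Finset.prod_mul_distrib, Finset.prod_pow, Finset.prod_inv_distrib,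
    Finset.prod_pow, div_pow]
  field_simp
  ring

theorem ae_pos_pi_erlangMeasure {n : ℕ} (κ : Fin n → ℕ) :
    ∀ᵐ r ∂Measure.pi (fun i => erlangMeasure (κ i)), ∀ j, 0 < r j := by
  have hs : MeasurableSet {r : Fin n → ℝ | ∀ j, 0 < r j} := by
    exact measurableSet_setOfPred.2 (by fun_prop)
  have h := lintegral_pi_erlangMeasure κ (measurable_one.indicator hs.compl)
  rw [lintegral_indicator_one hs.compl, setLIntegral_congr_fun (g := fun _ => 0) hs
    fun r hr => by rw [Set.indicator_of_notMem (Set.notMem_compl_iff.2 hr), mul_zero],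
    lintegral_zero] at h
  exact h

/-- Conditional law of the squared singular values after appending a Gaussian column. -/
theorem lintegral_sqSingularValues_appendCol {n k : ℕ}
    (A : Matrix (Fin (n + (k + 1))) (Fin n) ℂ) (σ : Equiv.Perm (Fin n))
    (hx : StrictMono (sqSingularValues A ∘ σ)) (hpos : ∀ j, 0 < sqSingularValues A j)
    {F : (Fin (n + 1) → ℝ) → ℝ≥0∞} (hFm : Measurable F)
    (hF : ∀ (σ : Equiv.Perm (Fin (n + 1))) (t : Fin (n + 1) → ℝ), F (t ∘ σ) = F t) :
    ∫⁻ v, F (sqSingularValues (appendCol A v)) ∂(Measure.pi fun _ => complexGaussian) =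
      ∫⁻ y in interlacingSet (Fin.cons 0 (sqSingularValues A ∘ σ)),
        ENNReal.ofReal (columnKernel k (sqSingularValues A ∘ σ) y) * F y := by
  obtain ⟨U, e, hU, hUv⟩ := exists_unitary_prod_one_sub_sqSingularValues_appendCol A σ
  set x : Fin n → ℝ := sqSingularValues A ∘ σ with hxdef
  have hxpos : ∀ j, 0 < x j := fun j => hpos _
  have ha := strictMono_cons_zero hx hxpos
  set a : Fin (n + 1) → ℝ := Fin.cons 0 x with hadef
  have hta : ∀ t < 0, ∀ j, t ≠ a j := by
    intro t ht j
    have : a 0 ≤ a j := ha.monotone (Fin.zero_le j)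
    exact (ht.trans_le this).ne
  classical
  -- A chosen inverse of the residue map, whose own measurability is not needed: `F ∘ g` is
  -- measurable because the polynomial of `g r` is affine in `r` on the orthant. The value `0` off
  -- the orthant is reached with probability zero.
  let g : (Fin (n + 1) → ℝ) → Fin (n + 1) → ℝ := fun r =>
    if h : ∀ j, 0 < r j then (surjOn_interlacingResidue ha h).choose else 0
  have hg : ∀ r : Fin (n + 1) → ℝ, (∀ j, 0 < r j) →
      g r ∈ interlacingSet a ∧ interlacingResidue a (g r) = r := by
    intro r h
    simp only [g, dif_pos h]
    exact (surjOn_interlacingResidue ha h).choose_spec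
  have hgt : ∀ r : Fin (n + 1) → ℝ, (∀ j, 0 < r j) → ∀ t < (0 : ℝ), ∏ i, (1 - g r i / t) =
      (∏ j, (1 - a j / t)) * (1 - ∑ j, r j / (t - a j)) := by
    intro r h t ht
    rw [prod_one_sub_div_eq_interlacingResidue ha.injective _ ht.ne (hta t ht), (hg r h).2]
  have hs : MeasurableSet {r : Fin (n + 1) → ℝ | ∀ j, 0 < r j} := by
    exact measurableSet_setOfPred.2 (by fun_prop)
  have hG : Measurable fun r => F (g r) := by
    refine measurable_symmetric_comp hFm hF fun t ht => ?_
    have : (fun r => ∏ i, (1 - g r i / t)) = fun r => if ∀ j, 0 < r j then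
        (∏ j, (1 - a j / t)) * (1 - ∑ j, r j / (t - a j)) else 1 := by
      ext r
      split_ifs with h
      · exact hgt r h t ht
      · simp [g, dif_neg h]
    rw [this]
    exact Measurable.ite hs (by fun_prop) measurable_const
  have hR := (measurePreserving_cons_sum_normSq n k).comp
    ((measurePreserving_pi_comp_equiv complexGaussian e.symm).comp
      (measurePreserving_mulVec_unitary hU))
  have hae := hR.quasiMeasurePreserving.ae (ae_pos_pi_erlangMeasure _)
  calc _ = ∫⁻ v, F (g _) ∂(Measure.pi fun _ => complexGaussian) := by
        refine lintegral_congr_ae ?_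
        filter_upwards [hae] with v hv
        refine symmetric_apply_eq_of_prod_eq hF fun t ht => ?_
        rw [hUv v t ht, hgt _ hv t ht]
        rfl
    _ = ∫⁻ r, F (g r) ∂_ := hR.lintegral_comp hG
    _ = _ := lintegral_pi_erlangMeasure _ hG
    _ = _ := lintegral_pos_eq_lintegral_interlacingSet ha _
    _ = _ := by
        refine setLIntegral_congr_fun (measurableSet_interlacingSet a) fun y hy => ?_
        rw [← mul_assoc, vandermondeProd_mul_prod_erlangDensity hx hxpos hy]
        congr 1
        have hy' := hg _ (interlacingResidue_pos hy)
        rw [injOn_interlacingResidue ha.injective hy'.1 hy hy'.2]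

/-! ### Symmetrization and determinants -/

theorem measurableSet_forall_pos (N : ℕ) : MeasurableSet {t : Fin N → ℝ | ∀ j, 0 < t j} :=
  measurableSet_setOfPred.2 (by fun_prop)

theorem measurableSet_strictMono (N : ℕ) : MeasurableSet {t : Fin N → ℝ | StrictMono t} := by
  have : {t : Fin N → ℝ | StrictMono t} = {t | ∀ i j, i < j → t i < t j} := rfl
  rw [this]
  exact measurableSet_setOfPred.2 (by fun_prop)

theorem measurePreserving_comp_perm_restrict_pos {N : ℕ} (σ : Equiv.Perm (Fin N)) :
    MeasurePreserving (fun t : Fin N → ℝ => t ∘ σ)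
      (volume.restrict {t : Fin N → ℝ | ∀ j, 0 < t j})
      (volume.restrict {t : Fin N → ℝ | ∀ j, 0 < t j}) := by
  have h := (measurePreserving_pi_comp_equiv (volume : Measure ℝ) σ).restrict_preimage
    (measurableSet_forall_pos N)
  convert! h using 2
  ext t
  exact ⟨fun h j => h (σ j), fun h j => by simpa using h (σ.symm j)⟩

theorem lintegral_pos_sum_perm {N : ℕ} {φ : (Fin N → ℝ) → ℝ≥0∞}
    (hφ : AEMeasurable φ (volume.restrict {t : Fin N → ℝ | ∀ j, 0 < t j})) :
    ∫⁻ t in {t : Fin N → ℝ | ∀ j, 0 < t j}, ∑ σ : Equiv.Perm (Fin N), φ (t ∘ σ) =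
      N.factorial * ∫⁻ t in {t : Fin N → ℝ | ∀ j, 0 < t j}, φ t := by
  have hmp := fun σ : Equiv.Perm (Fin N) => measurePreserving_comp_perm_restrict_pos σ
  rw [lintegral_finsetSum' (f := fun σ : Equiv.Perm (Fin N) => fun t => φ (t ∘ σ)) _
    fun σ _ => hφ.comp_quasiMeasurePreserving (hmp σ).quasiMeasurePreserving]
  have : ∀ σ : Equiv.Perm (Fin N), ∫⁻ t in {t : Fin N → ℝ | ∀ j, 0 < t j}, φ (t ∘ σ) =
      ∫⁻ t in {t : Fin N → ℝ | ∀ j, 0 < t j}, φ t := fun σ => by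
    rw [← lintegral_map' (f := φ) (by rwa [(hmp σ).map_eq]) (hmp σ).aemeasurable, (hmp σ).map_eq]
  simp [this, Finset.card_univ, Fintype.card_perm]

/-- Exactly one permutation sorts a tuple of distinct points. -/
theorem sum_indicator_strictMono_comp {N : ℕ} {M : Type*} [AddCommMonoid M] {t : Fin N → ℝ}
    (ht : Function.Injective t) (φ : (Fin N → ℝ) → M) :
    ∑ σ : Equiv.Perm (Fin N), {t : Fin N → ℝ | StrictMono t}.indicator φ (t ∘ σ) =
      φ (t ∘ Tuple.sort t) := by
  rw [Finset.sum_eq_single (Tuple.sort t)]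
  · exact Set.indicator_of_mem ((Tuple.monotone_sort t).strictMono_of_injective
      (ht.comp (Tuple.sort t).injective)) _
  · intro σ _ hσ
    refine Set.indicator_of_notMem (fun h : StrictMono (t ∘ σ) => hσ ?_) _
    have := Tuple.unique_monotone h.monotone (Tuple.monotone_sort t)
    exact Equiv.ext fun i => ht (congrFun this i)
  · exact fun h => absurd (Finset.mem_univ _) h

theorem polyEnsembleDensity_comp_perm {N : ℕ} (Z : ℝ) (f : Fin N → ℝ → ℝ)
    (σ : Equiv.Perm (Fin N)) (t : Fin N → ℝ) :
    polyEnsembleDensity Z f (t ∘ σ) = polyEnsembleDensity Z f t := by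
  have h1 : Matrix.vandermonde (t ∘ σ) = (Matrix.vandermonde t).submatrix σ id := rfl
  have h2 : (Matrix.of fun j k : Fin N => f k ((t ∘ σ) j)) =
      (Matrix.of fun j k : Fin N => f k (t j)).submatrix σ id := rfl
  rw [polyEnsembleDensity, polyEnsembleDensity, vandermondeProd_eq_det, vandermondeProd_eq_det, h1,
    h2, Matrix.det_permute, Matrix.det_permute]
  have h3 : (((Equiv.Perm.sign σ : ℤˣ) : ℤ) : ℝ) * ((Equiv.Perm.sign σ : ℤˣ) : ℤ) = 1 := by
    rw [← Int.cast_mul, Int.units_coe_mul_self, Int.cast_one]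
  linear_combination (Z⁻¹ * (Matrix.vandermonde t).det *
    (Matrix.of fun j k : Fin N => f k (t j)).det) * h3

theorem polyEnsembleDensity_of_not_injective {N : ℕ} (Z : ℝ) (f : Fin N → ℝ → ℝ)
    {t : Fin N → ℝ} (ht : ¬ Function.Injective t) : polyEnsembleDensity Z f t = 0 := by
  have : vandermondeProd t = 0 := by
    rw [vandermondeProd_eq_det]
    by_contra h
    exact ht (Matrix.det_vandermonde_ne_zero_iff.1 h)
  rw [polyEnsembleDensity, this, mul_zero, zero_mul]

/-- Subtract from each row the preceding one, then expand along the first column, now `(1, 0, …,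
0)`. -/
theorem det_one_column_eq_det_sub {n : ℕ} (G : Fin (n + 1) → Fin n → ℝ) :
    (Matrix.of fun j : Fin (n + 1) => (Fin.cons 1 (G j) : Fin (n + 1) → ℝ)).det =
      (Matrix.of fun j k : Fin n => G j.succ k - G j.castSucc k).det := by
  let B : Matrix (Fin (n + 1)) (Fin (n + 1)) ℝ := Matrix.of fun j =>
    Fin.cases (Fin.cons 1 (G 0)) (fun i => Fin.cons 0 fun k => G i.succ k - G i.castSucc k) j
  have hB : (Matrix.of fun j : Fin (n + 1) => (Fin.cons 1 (G j) : Fin (n + 1) → ℝ)).det = B.det := by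
    refine Matrix.det_eq_of_forall_row_eq_smul_add_pred (fun _ => 1) (fun j => rfl) fun i j => ?_
    refine Fin.cases ?_ (fun k => ?_) j <;> simp [B]
  rw [hB, Matrix.det_succ_column_zero, Fin.sum_univ_succ]
  simp only [B, Matrix.of_apply, Fin.cases_zero, Fin.cons_zero, Fin.cases_succ, mul_zero, zero_mul,
    Finset.sum_const_zero, add_zero, Fin.val_zero, pow_zero, one_mul]
  congr 1

theorem det_of_eq_sum_perm {n : ℕ} (ψ : Fin n → Fin n → ℝ) :
    (Matrix.of ψ).det =
      ∑ σ : Equiv.Perm (Fin n), ((Equiv.Perm.sign σ : ℤ) : ℝ) * ∏ i, ψ i (σ i) := by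
  rw [← Matrix.det_transpose, Matrix.det_apply']
  rfl

theorem integrableOn_pi_det {n : ℕ} {φ : Fin n → ℝ → ℝ} {s : Fin n → Set ℝ}
    (hφ : ∀ j k, IntegrableOn (φ k) (s j)) :
    IntegrableOn (fun x : Fin n → ℝ => (Matrix.of fun j k => φ k (x j)).det) (Set.univ.pi s) := by
  simp_rw [det_of_eq_sum_perm, IntegrableOn, volume_pi, Measure.restrict_pi_pi]
  refine integrable_finsetSum _ fun σ _ => Integrable.const_mul ?_ _
  exact Integrable.fintype_prod (f := fun i => φ (σ i)) (μ := fun i => volume.restrict (s i))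
    fun i => hφ i (σ i)

theorem setIntegral_pi_det {n : ℕ} {φ : Fin n → ℝ → ℝ} {s : Fin n → Set ℝ}
    (hφ : ∀ j k, IntegrableOn (φ k) (s j)) :
    ∫ x in Set.univ.pi s, (Matrix.of fun j k => φ k (x j)).det =
      (Matrix.of fun j k => ∫ t in s j, φ k t).det := by
  simp_rw [det_of_eq_sum_perm, volume_pi, Measure.restrict_pi_pi]
  rw [integral_finsetSum]
  · refine Finset.sum_congr rfl fun σ _ => ?_
    rw [integral_const_mul, integral_fintype_prod_eq_prod fun i => φ (σ i)]
  · intro σ _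
    refine Integrable.const_mul ?_ _
    exact Integrable.fintype_prod (f := fun i => φ (σ i)) (μ := fun i => volume.restrict (s i))
      fun i => hφ i (σ i)

theorem mem_interlacingSet_cons_zero_iff {n : ℕ} {x : Fin n → ℝ} {y : Fin (n + 1) → ℝ} :
    y ∈ interlacingSet (Fin.cons 0 x) ↔
      0 < y 0 ∧ ∀ j : Fin n, y j.castSucc < x j ∧ x j < y j.succ := by
  constructor
  · intro h
    refine ⟨by simpa using h.1 0, fun j => ⟨?_, by simpa using h.1 j.succ⟩⟩
    simpa using h.2 j.castSucc j.succ Fin.castSucc_lt_succ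
  · rintro ⟨h0, h⟩
    have hy : StrictMono y := Fin.strictMono_iff_lt_succ.2 fun j => (h j).1.trans (h j).2
    refine ⟨fun i => ?_, fun i j => ?_⟩
    · refine Fin.cases ?_ (fun j => ?_) i
      · simpa using h0
      · simpa using (h j).2
    · refine Fin.cases (fun hi => absurd hi (Fin.not_lt_zero i)) (fun j hij => ?_) j
      rw [Fin.cons_succ]
      exact (hy.monotone (Fin.le_castSucc_iff.2 hij)).trans_lt (h j).1

/-! ### Convergence of the moments of the new functions -/

theorem integrableOn_pow_mul_exp_neg (q : ℕ) :
    IntegrableOn (fun y : ℝ => y ^ q * Real.exp (-y)) (Set.Ioi 0) := by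
  have h := Real.GammaIntegral_convergent (s := q + 1) (by positivity)
  refine h.congr_fun (fun y _ => ?_) measurableSet_Ioi
  simp [mul_comm]

/-- The upper incomplete Gamma function is bounded by a multiple of its integrand. -/
theorem exists_lintegral_Ioi_pow_mul_exp_neg_le {c : ℝ} (hc : 0 < c) (q : ℕ) :
    ∃ C : ℝ≥0∞, C ≠ ∞ ∧ ∀ x, c < x →
      ∫⁻ y in Set.Ioi x, ENNReal.ofReal (y ^ q * Real.exp (-y)) ≤
        C * ENNReal.ofReal (x ^ q * Real.exp (-x)) := by
  -- After the shift `y = u + x`, the bound `(u + x)^q ≤ x^q * 2^(q-1) * (1 + (u/c)^q)` for `x > c`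
  -- leaves an integrand free of `x`.
  refine ⟨∫⁻ u in Set.Ioi 0, ENNReal.ofReal
    (2 ^ (q - 1) * (u ^ 0 * Real.exp (-u) + (c ^ q)⁻¹ * (u ^ q * Real.exp (-u)))), ?_, fun x hx => ?_⟩
  · have h : IntegrableOn (fun u : ℝ =>
        2 ^ (q - 1) * (u ^ 0 * Real.exp (-u) + (c ^ q)⁻¹ * (u ^ q * Real.exp (-u)))) (Set.Ioi 0) :=
      ((integrableOn_pow_mul_exp_neg 0).add
        ((integrableOn_pow_mul_exp_neg q).const_mul _)).const_mul _
    exact h.lintegral_lt_top.ne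
  · have hx0 : 0 < x := hc.trans hx
    rw [← lintegral_mul_const' _ _ ENNReal.ofReal_ne_top, ← lintegral_indicator measurableSet_Ioi,
      ← lintegral_indicator measurableSet_Ioi, ← lintegral_add_right_eq_self _ x]
    refine lintegral_mono fun u => ?_
    by_cases hu : 0 < u
    · rw [Set.indicator_of_mem (show u + x ∈ Set.Ioi x by simpa using hu),
        Set.indicator_of_mem (show u ∈ Set.Ioi 0 from hu), ← ENNReal.ofReal_mul (by positivity)]
      refine ENNReal.ofReal_le_ofReal ?_
      have h1 : (u + x) ^ q ≤ x ^ q * (2 ^ (q - 1) * (1 + (c ^ q)⁻¹ * u ^ q)) := by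
        calc (u + x) ^ q = x ^ q * (1 + u / x) ^ q := by
              rw [← mul_pow]; congr 1; field_simp; ring
          _ ≤ x ^ q * (1 + u / c) ^ q := by gcongr
          _ ≤ x ^ q * (2 ^ (q - 1) * (1 ^ q + (u / c) ^ q)) := by
              gcongr
              exact add_pow_le zero_le_one (by positivity) q
          _ = _ := by rw [one_pow, div_pow, div_eq_inv_mul]
      calc (u + x) ^ q * Real.exp (-(u + x))
          ≤ x ^ q * (2 ^ (q - 1) * (1 + (c ^ q)⁻¹ * u ^ q)) * Real.exp (-(u + x)) := by gcongr
        _ = _ := by rw [neg_add, Real.exp_add]; ring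
    · rw [Set.indicator_of_notMem (show u + x ∉ Set.Ioi x by simpa using hu)]
      exact zero_le

theorem intervalIntegrable_inv_pow_mul_exp_mul {f : ℝ → ℝ} (hf : IntegrableOn f (Set.Ioi 0))
    (ν : ℕ) {a b : ℝ} (ha : 0 < a) (hb : 0 < b) :
    IntervalIntegrable (fun x => (x ^ ν)⁻¹ * Real.exp x * f x) volume a b := by
  have hsub : Set.uIcc a b ⊆ Set.Ioi 0 := fun x hx => (lt_min ha hb).trans_le hx.1
  rw [intervalIntegrable_iff']
  refine IntegrableOn.continuousOn_mul ?_ (hf.mono_set hsub) isCompact_uIcc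
  refine ContinuousOn.mul (ContinuousOn.inv₀ (by fun_prop) fun x hx => ?_) (by fun_prop)
  exact pow_ne_zero _ (ne_of_gt (hsub hx))

theorem continuousOn_primitive_inv_pow_mul_exp_mul {f : ℝ → ℝ} (hf : IntegrableOn f (Set.Ioi 0))
    (ν : ℕ) {c : ℝ} (hc : 0 < c) :
    ContinuousOn (fun y => ∫ x in c..y, (x ^ ν)⁻¹ * Real.exp x * f x) (Set.Ioi 0) := by
  intro y (hy : 0 < y)
  have ha : 0 < min c y / 2 := half_pos (lt_min hc hy)
  have hb : 0 < max c y + 1 := by positivity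
  have hac : min c y / 2 < c := (half_lt_self (lt_min hc hy)).trans_le (min_le_left _ _)
  have hay : min c y / 2 < y := (half_lt_self (lt_min hc hy)).trans_le (min_le_right _ _)
  have hcb : c < max c y + 1 := (le_max_left c y).trans_lt (lt_add_one _)
  have hyb : y < max c y + 1 := (le_max_right c y).trans_lt (lt_add_one _)
  have h := intervalIntegral.continuousOn_primitive_interval' (a := c)
    (intervalIntegrable_inv_pow_mul_exp_mul hf ν ha hb) (Set.mem_uIcc_of_le hac.le hcb.le)
  rw [Set.uIcc_of_le (hac.trans hcb).le] at h
  exact (h.continuousAt (Icc_mem_nhds hay hyb)).continuousWithinAt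

/-- By Tonelli the absolute integral is that of `|φ x|` against the weight of those `y` for which
`x` lies between `c` and `y`: `y ≥ x` if `x > c`, and `y < x` if `x ≤ c`. The tail weight is
`O(x^(m+k) e^(-x))`, so one power of `x` is gained at infinity; this is why `m = p + 1` is
admissible, as the one additional moment of the larger ensemble requires. -/
theorem integrableOn_pow_mul_columnExtension {f : ℝ → ℝ} {c : ℝ} (hc : 0 < c) {p m k : ℕ}
    (hm : m = p ∨ m = p + 1) (hf : IntegrableOn f (Set.Ioi 0))
    (hfp : IntegrableOn (fun t => t ^ p * f t) (Set.Ioi 0)) :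
    IntegrableOn (fun y => y ^ m * (y ^ k * Real.exp (-y) *
      ∫ x in c..y, (x ^ (k + 1))⁻¹ * Real.exp x * f x)) (Set.Ioi 0) := by
  set φ : ℝ → ℝ := fun x => (x ^ (k + 1))⁻¹ * Real.exp x * f x with hφdef
  have hφm : AEMeasurable (fun x => ‖φ x‖ₑ) (volume.restrict (Set.Ioi 0)) := by
    refine (AEMeasurable.mul ?_ hf.aemeasurable).enorm
    exact Measurable.aemeasurable (by fun_prop)
  let w : ℝ → ℝ≥0∞ := fun y => ENNReal.ofReal (y ^ (m + k) * Real.exp (-y))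
  have hw : Measurable w := by fun_prop
  refine ⟨?_, ?_⟩
  · refine ContinuousOn.aestronglyMeasurable ?_ measurableSet_Ioi
    exact ContinuousOn.mul (by fun_prop)
      (ContinuousOn.mul (by fun_prop) (continuousOn_primitive_inv_pow_mul_exp_mul hf _ hc))
  obtain ⟨C, hC, hCx⟩ := exists_lintegral_Ioi_pow_mul_exp_neg_le hc (m + k)
  have hS : MeasurableSet {z : ℝ × ℝ | min c z.1 < z.2 ∧ z.2 ≤ max c z.1} :=
    measurableSet_setOfPred.2 (by fun_prop)
  have hSx : ∀ x, MeasurableSet {y | x ∈ Set.uIoc c y} := fun x => by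
    have : Measurable fun y => min c y < x ∧ x ≤ max c y := by fun_prop
    exact measurableSet_setOfPred.2 this
  have hset : ∀ y, 0 < y → Set.uIoc c y ⊆ Set.Ioi 0 := fun y hy x hx => (lt_min hc hy).trans hx.1
  -- The constant covers all cases at once: `c⁻¹` for `m = p` and `1` for `m = p + 1` when `x > c`;
  -- `1` and `c` respectively when `x ≤ c`, where `exp c` bounds `exp x`.
  have hkey : ∀ x, 0 < x → ‖φ x‖ₑ * ∫⁻ y in Set.Ioi 0, {y | x ∈ Set.uIoc c y}.indicator w y ≤
      (C + 1) * ENNReal.ofReal ((1 + c + c⁻¹) * Real.exp c) * ‖x ^ p * f x‖ₑ := by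
    intro x hx
    have hφx : ‖φ x‖ₑ = ENNReal.ofReal ((x ^ (k + 1))⁻¹ * Real.exp x * |f x|) := by
      rw [← ofReal_norm]
      congr 1
      simp only [φ, norm_mul, norm_inv, norm_pow, Real.norm_eq_abs, abs_of_pos hx, Real.abs_exp]
    have hfx : ‖x ^ p * f x‖ₑ = ENNReal.ofReal (x ^ p * |f x|) := by
      rw [← ofReal_norm]
      congr 1
      simp only [norm_mul, norm_pow, Real.norm_eq_abs, abs_of_pos hx]
    have hexp1 : 1 ≤ Real.exp c := Real.one_le_exp hc.le
    have hci : 0 < c⁻¹ := inv_pos.2 hc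
    have hTset : ∫⁻ y in Set.Ioi 0, {y | x ∈ Set.uIoc c y}.indicator w y =
        ∫⁻ y in {y | x ∈ Set.uIoc c y} ∩ Set.Ioi 0, w y := by
      rw [lintegral_indicator (hSx x), Measure.restrict_restrict (hSx x)]
    rw [hTset, hφx, hfx]
    rcases lt_or_ge c x with hcx | hcx
    · have hT : ∫⁻ y in {y | x ∈ Set.uIoc c y} ∩ Set.Ioi 0, w y ≤
          C * ENNReal.ofReal (x ^ (m + k) * Real.exp (-x)) := by
        refine le_trans ?_ (hCx x hcx)
        rw [setLIntegral_congr Ioi_ae_eq_Ici]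
        refine lintegral_mono_set fun y hy => ?_
        exact (le_max_iff.1 hy.1.2).resolve_left hcx.not_ge
      have hreal : (x ^ (k + 1))⁻¹ * Real.exp x * |f x| * (x ^ (m + k) * Real.exp (-x)) ≤
          (1 + c + c⁻¹) * Real.exp c * (x ^ p * |f x|) := by
        have e1 : (x ^ (k + 1))⁻¹ * Real.exp x * |f x| * (x ^ (m + k) * Real.exp (-x)) =
            x⁻¹ * x ^ m * |f x| := by
          rw [Real.exp_neg]
          field_simp
          ring
        have e2 : x⁻¹ * x ^ m ≤ (1 + c + c⁻¹) * x ^ p := by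
          have hxi : x⁻¹ ≤ c⁻¹ := inv_anti₀ hc hcx.le
          rcases hm with rfl | rfl
          · gcongr
            linarith
          · rw [pow_succ, mul_comm (x ^ p), inv_mul_cancel_left₀ hx.ne']
            exact le_mul_of_one_le_left (by positivity) (by linarith)
        rw [e1]
        calc x⁻¹ * x ^ m * |f x| ≤ (1 + c + c⁻¹) * x ^ p * |f x| := by gcongr
          _ ≤ (1 + c + c⁻¹) * x ^ p * |f x| * Real.exp c :=
              le_mul_of_one_le_right (by positivity) hexp1
          _ = _ := by ring
      calc _ ≤ ENNReal.ofReal ((x ^ (k + 1))⁻¹ * Real.exp x * |f x|) *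
            (C * ENNReal.ofReal (x ^ (m + k) * Real.exp (-x))) := by gcongr
        _ = C * ENNReal.ofReal ((x ^ (k + 1))⁻¹ * Real.exp x * |f x| *
            (x ^ (m + k) * Real.exp (-x))) := by
            rw [ENNReal.ofReal_mul (by positivity : 0 ≤ (x ^ (k + 1))⁻¹ * Real.exp x * |f x|)]
            ring
        _ ≤ (C + 1) * ENNReal.ofReal ((1 + c + c⁻¹) * Real.exp c * (x ^ p * |f x|)) := by
            gcongr
            exact le_self_add
        _ = _ := by rw [ENNReal.ofReal_mul (by positivity), mul_assoc]
    · have hT : ∫⁻ y in {y | x ∈ Set.uIoc c y} ∩ Set.Ioi 0, w y ≤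
          ENNReal.ofReal (x ^ (m + k) * x) := by
        calc _ ≤ ∫⁻ y in Set.Ioo 0 x, w y := by
              refine lintegral_mono_set fun y hy => ⟨hy.2, ?_⟩
              exact (min_lt_iff.1 hy.1.1).resolve_left hcx.not_gt
          _ ≤ ∫⁻ _ in Set.Ioo 0 x, ENNReal.ofReal (x ^ (m + k)) := by
              refine setLIntegral_mono' measurableSet_Ioo fun y hy => ENNReal.ofReal_le_ofReal ?_
              have h1 : y ^ (m + k) ≤ x ^ (m + k) := pow_le_pow_left₀ hy.1.le hy.2.le _
              have h2 : Real.exp (-y) ≤ 1 := Real.exp_le_one_iff.2 (by linarith [hy.1])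
              calc _ ≤ x ^ (m + k) * 1 := by gcongr
                _ = _ := mul_one _
          _ = _ := by
              rw [lintegral_const, Measure.restrict_apply_univ, Real.volume_Ioo, sub_zero,
                ENNReal.ofReal_mul (by positivity)]
      have hreal : (x ^ (k + 1))⁻¹ * Real.exp x * |f x| * (x ^ (m + k) * x) ≤
          (1 + c + c⁻¹) * Real.exp c * (x ^ p * |f x|) := by
        have e1 : (x ^ (k + 1))⁻¹ * Real.exp x * |f x| * (x ^ (m + k) * x) =
            x ^ m * Real.exp x * |f x| := by
          field_simp
          ring
        have e2 : x ^ m ≤ (1 + c + c⁻¹) * x ^ p := by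
          rcases hm with rfl | rfl
          · exact le_mul_of_one_le_left (by positivity) (by linarith)
          · rw [pow_succ, mul_comm]
            gcongr
            linarith
        have e3 : Real.exp x ≤ Real.exp c := Real.exp_le_exp.2 hcx
        rw [e1]
        calc x ^ m * Real.exp x * |f x| ≤ (1 + c + c⁻¹) * x ^ p * Real.exp c * |f x| := by gcongr
          _ = _ := by ring
      calc _ ≤ ENNReal.ofReal ((x ^ (k + 1))⁻¹ * Real.exp x * |f x|) *
            ENNReal.ofReal (x ^ (m + k) * x) := by gcongr
        _ = 1 * ENNReal.ofReal ((x ^ (k + 1))⁻¹ * Real.exp x * |f x| * (x ^ (m + k) * x)) := by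
            rw [one_mul, ENNReal.ofReal_mul (by positivity : 0 ≤ (x ^ (k + 1))⁻¹ * Real.exp x * |f x|)]
        _ ≤ (C + 1) * ENNReal.ofReal ((1 + c + c⁻¹) * Real.exp c * (x ^ p * |f x|)) := by
            gcongr
            exact le_add_self
        _ = _ := by rw [ENNReal.ofReal_mul (by positivity), mul_assoc]
  calc _ ≤ ∫⁻ y in Set.Ioi 0, ∫⁻ x in Set.Ioi 0, ‖φ x‖ₑ * {y | x ∈ Set.uIoc c y}.indicator w y := by
        refine setLIntegral_mono' measurableSet_Ioi fun y (hy : 0 < y) => ?_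
        have h1 : ‖∫ x in c..y, φ x‖ₑ ≤ ∫⁻ x in Set.uIoc c y, ‖φ x‖ₑ := by
          rw [← ofReal_norm, intervalIntegral.norm_intervalIntegral_eq,
            ofReal_norm]
          exact enorm_integral_le_lintegral_enorm _
        have h2 : ‖y ^ m * (y ^ k * Real.exp (-y) * ∫ x in c..y, φ x)‖ₑ =
            w y * ‖∫ x in c..y, φ x‖ₑ := by
          rw [← mul_assoc, ← mul_assoc, ← pow_add, enorm_mul, Real.enorm_of_nonneg (by positivity)]
        rw [h2]
        refine (mul_le_mul_right h1 _).trans (le_of_eq ?_)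
        rw [← lintegral_const_mul' _ _ ENNReal.ofReal_ne_top,
          ← Measure.restrict_restrict_of_subset (hset y hy),
          ← lintegral_indicator measurableSet_uIoc]
        refine lintegral_congr fun x => ?_
        by_cases hx : x ∈ Set.uIoc c y
        · simp [hx, mul_comm, w]
        · simp [hx]
    _ = ∫⁻ x in Set.Ioi 0, ∫⁻ y in Set.Ioi 0, ‖φ x‖ₑ * {y | x ∈ Set.uIoc c y}.indicator w y := by
        refine lintegral_lintegral_swap ?_
        refine AEMeasurable.mul hφm.comp_snd (Measurable.aemeasurable ?_)
        exact (hw.comp measurable_fst).indicator hS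
    _ = ∫⁻ x in Set.Ioi 0, ‖φ x‖ₑ * ∫⁻ y in Set.Ioi 0, {y | x ∈ Set.uIoc c y}.indicator w y := by
        refine lintegral_congr fun x => lintegral_const_mul _ (hw.indicator (hSx x))
    _ ≤ ∫⁻ x in Set.Ioi 0, (C + 1) * ENNReal.ofReal ((1 + c + c⁻¹) * Real.exp c) *
          ‖x ^ p * f x‖ₑ := setLIntegral_mono' measurableSet_Ioi hkey
    _ < ∞ := by
        rw [lintegral_const_mul'' _ hfp.aemeasurable.enorm]
        exact ENNReal.mul_lt_top (ENNReal.mul_lt_top (by simpa using hC.lt_top) ENNReal.ofReal_lt_top)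
          hfp.2

/-! ### Integrating the kernel against the density over a box -/

theorem det_columnExtensionFunctions {n k : ℕ} {c : ℝ} (hc : 0 < c) {f : Fin n → ℝ → ℝ}
    (hf : ∀ i, IntegrableOn (f i) (Set.Ioi 0)) {y : Fin (n + 1) → ℝ} (hy : ∀ j, 0 < y j) :
    (Matrix.of fun j i => columnExtensionFunctions (k + 1) c f i (y j)).det =
      (∏ j, y j ^ k * Real.exp (-y j)) * (Matrix.of fun (j : Fin n) (i : Fin n) =>
        ∫ x in y j.castSucc..y j.succ, (x ^ (k + 1))⁻¹ * Real.exp x * f i x).det := by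
  have hint : ∀ i a b, 0 < a → 0 < b →
      IntervalIntegrable (fun x => (x ^ (k + 1))⁻¹ * Real.exp x * f i x) volume a b :=
    fun i a b ha hb => intervalIntegrable_inv_pow_mul_exp_mul (hf i) _ ha hb
  have h1 : (Matrix.of fun j i => columnExtensionFunctions (k + 1) c f i (y j)) =
      Matrix.of fun j i => (y j ^ k * Real.exp (-y j)) *
        (Matrix.of fun j : Fin (n + 1) => (Fin.cons 1 fun i =>
          ∫ x in c..y j, (x ^ (k + 1))⁻¹ * Real.exp x * f i x : Fin (n + 1) → ℝ)) j i := by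
    ext j i
    refine Fin.cases ?_ (fun i => ?_) i <;> simp [columnExtensionFunctions]
  rw [h1, Matrix.det_mul_column, det_one_column_eq_det_sub]
  congr 3
  ext j i
  exact intervalIntegral.integral_interval_sub_left (hint i _ _ hc (hy _)) (hint i _ _ hc (hy _))

section Box
variable {n k : ℕ} {c Z : ℝ} {f : Fin n → ℝ → ℝ} {y : Fin (n + 1) → ℝ}

theorem columnKernel_mul_polyEnsembleDensity (Z : ℝ) (f : Fin n → ℝ → ℝ) (y : Fin (n + 1) → ℝ)
    {x : Fin n → ℝ} (hx : StrictMono x) :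
    columnKernel k x y * polyEnsembleDensity Z f x =
      vandermondeProd y * (∏ j, y j ^ k * Real.exp (-y j)) / k.factorial *
        (Z⁻¹ * (Matrix.of fun j i => (x j ^ (k + 1))⁻¹ * Real.exp (x j) * f i (x j)).det) := by
  have h : (Matrix.of fun j i => (x j ^ (k + 1))⁻¹ * Real.exp (x j) * f i (x j)).det =
      (∏ j, (x j ^ (k + 1))⁻¹ * Real.exp (x j)) * (Matrix.of fun j i => f i (x j)).det :=
    Matrix.det_mul_column (fun j => (x j ^ (k + 1))⁻¹ * Real.exp (x j))
      (Matrix.of fun j i => f i (x j))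
  have := (vandermondeProd_pos hx).ne'
  rw [h, columnKernel, polyEnsembleDensity]
  field_simp

theorem inv_mul_det_weighted_nonneg
    (hpos : ∀ t : Fin n → ℝ, (∀ j, 0 < t j) → 0 ≤ polyEnsembleDensity Z f t)
    {x : Fin n → ℝ} (hx : StrictMono x) (hx0 : ∀ j, 0 < x j) :
    0 ≤ Z⁻¹ * (Matrix.of fun j i => (x j ^ (k + 1))⁻¹ * Real.exp (x j) * f i (x j)).det := by
  have h : (Matrix.of fun j i => (x j ^ (k + 1))⁻¹ * Real.exp (x j) * f i (x j)).det =
      (∏ j, (x j ^ (k + 1))⁻¹ * Real.exp (x j)) * (Matrix.of fun j i => f i (x j)).det :=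
    Matrix.det_mul_column (fun j => (x j ^ (k + 1))⁻¹ * Real.exp (x j))
      (Matrix.of fun j i => f i (x j))
  have h1 := hpos x hx0
  have hV := vandermondeProd_pos hx
  have h2 : 0 ≤ Z⁻¹ * (Matrix.of fun j i => f i (x j)).det := by
    refine nonneg_of_mul_nonneg_right (b := Z⁻¹ * (Matrix.of fun j i => f i (x j)).det) ?_ hV
    rw [polyEnsembleDensity] at h1
    linarith
  have h3 : 0 ≤ ∏ j, (x j ^ (k + 1))⁻¹ * Real.exp (x j) := Finset.prod_nonneg fun j _ => by
    have := hx0 j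
    positivity
  rw [h]
  calc 0 ≤ (∏ j, (x j ^ (k + 1))⁻¹ * Real.exp (x j)) *
        (Z⁻¹ * (Matrix.of fun j i => f i (x j)).det) := mul_nonneg h3 h2
    _ = _ := by ring

/-- As a condition on `x`, interlacing is a product of intervals; this lets the determinant be
integrated one row at a time. -/
theorem setOf_mem_interlacingSet_cons_zero (hy0 : 0 < y 0) :
    {x : Fin n → ℝ | y ∈ interlacingSet (Fin.cons 0 x)} =
      Set.univ.pi fun j => Set.Ioo (y j.castSucc) (y j.succ) := by
  ext x
  rw [Set.mem_ofPred_eq, mem_interlacingSet_cons_zero_iff]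
  simp [hy0]

theorem strictMono_of_mem_interlacingSet_cons_zero {x : Fin n → ℝ}
    (h : y ∈ interlacingSet (Fin.cons 0 x)) : StrictMono x ∧ ∀ j, 0 < x j := by
  have ha : StrictMono (Fin.cons 0 x : Fin (n + 1) → ℝ) :=
    fun i j hij => (h.1 i).trans (h.2 i j hij)
  exact ⟨fun i j hij => by simpa using ha (Fin.succ_lt_succ_iff.2 hij),
    fun j => by simpa using ha (Fin.succ_pos j)⟩

theorem integrableOn_box (hf : ∀ i, IntegrableOn (f i) (Set.Ioi 0)) (hy : ∀ j, 0 < y j)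
    (j i : Fin n) : IntegrableOn (fun x => (x ^ (k + 1))⁻¹ * Real.exp x * f i x)
      (Set.Ioo (y j.castSucc) (y j.succ)) :=
  (intervalIntegrable_inv_pow_mul_exp_mul (hf i) _ (hy _) (hy _)).1.mono_set
    Set.Ioo_subset_Ioc_self

theorem setIntegral_box_det (hf : ∀ i, IntegrableOn (f i) (Set.Ioi 0)) (hy : ∀ j, 0 < y j)
    (hym : StrictMono y) :
    ∫ x in Set.univ.pi fun j : Fin n => Set.Ioo (y j.castSucc) (y j.succ),
      (Matrix.of fun j i => (x j ^ (k + 1))⁻¹ * Real.exp (x j) * f i (x j)).det =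
    (Matrix.of fun (j : Fin n) (i : Fin n) =>
        ∫ x in y j.castSucc..y j.succ, (x ^ (k + 1))⁻¹ * Real.exp x * f i x).det := by
  rw [setIntegral_pi_det (φ := fun i x => (x ^ (k + 1))⁻¹ * Real.exp x * f i x)
    (integrableOn_box hf hy)]
  congr 2
  ext j i
  rw [intervalIntegral.integral_of_le (hym Fin.castSucc_lt_succ).le, integral_Ioc_eq_integral_Ioo]

/-- In the constant `(n + 1) * k! * Z`, the factor `k!` normalizes the Gamma density, and `n + 1` is
the ratio of the numbers of orderings of `y` and of `x`. -/
theorem polyEnsembleDensity_columnExtension (hc : 0 < c)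
    (hf : ∀ i, IntegrableOn (f i) (Set.Ioi 0)) (hy : ∀ j, 0 < y j) (hym : StrictMono y) :
    (n + 1) * polyEnsembleDensity ((n + 1) * k.factorial * Z)
        (columnExtensionFunctions (k + 1) c f) y =
      vandermondeProd y * (∏ j, y j ^ k * Real.exp (-y j)) / k.factorial *
        ∫ x in Set.univ.pi fun j : Fin n => Set.Ioo (y j.castSucc) (y j.succ),
          Z⁻¹ * (Matrix.of fun j i => (x j ^ (k + 1))⁻¹ * Real.exp (x j) * f i (x j)).det := by
  rw [integral_const_mul, setIntegral_box_det hf hy hym, polyEnsembleDensity,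
    det_columnExtensionFunctions hc hf hy, mul_inv, mul_inv]
  field_simp

theorem setIntegral_box_nonneg
    (hpos : ∀ t : Fin n → ℝ, (∀ j, 0 < t j) → 0 ≤ polyEnsembleDensity Z f t)
    (hy : ∀ j, 0 < y j) :
    ∀ x ∈ Set.univ.pi fun j : Fin n => Set.Ioo (y j.castSucc) (y j.succ),
      0 ≤ Z⁻¹ * (Matrix.of fun j i => (x j ^ (k + 1))⁻¹ * Real.exp (x j) * f i (x j)).det := by
  intro x hx
  rw [← setOf_mem_interlacingSet_cons_zero (hy 0)] at hx
  obtain ⟨h1, h2⟩ := strictMono_of_mem_interlacingSet_cons_zero hx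
  exact inv_mul_det_weighted_nonneg hpos h1 h2

theorem polyEnsembleDensity_columnExtension_nonneg (hc : 0 < c)
    (hf : ∀ i, IntegrableOn (f i) (Set.Ioi 0))
    (hpos : ∀ t : Fin n → ℝ, (∀ j, 0 < t j) → 0 ≤ polyEnsembleDensity Z f t)
    {t : Fin (n + 1) → ℝ} (ht : ∀ j, 0 < t j) :
    0 ≤ polyEnsembleDensity ((n + 1) * k.factorial * Z)
      (columnExtensionFunctions (k + 1) c f) t := by
  by_cases hinj : Function.Injective t
  · rw [← polyEnsembleDensity_comp_perm _ _ (Tuple.sort t)]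
    have hy : ∀ j, 0 < (t ∘ Tuple.sort t) j := fun j => ht _
    have hym : StrictMono (t ∘ Tuple.sort t) :=
      (Tuple.monotone_sort t).strictMono_of_injective (hinj.comp (Tuple.sort t).injective)
    refine nonneg_of_mul_nonneg_right (a := (n + 1 : ℝ)) ?_ (by positivity)
    rw [polyEnsembleDensity_columnExtension hc hf hy hym]
    refine mul_nonneg (div_nonneg (mul_nonneg (vandermondeProd_pos hym).le
      (Finset.prod_nonneg fun j _ => ?_)) (by positivity)) (setIntegral_nonneg
        (MeasurableSet.univ_pi fun _ => measurableSet_Ioo) (setIntegral_box_nonneg hpos hy))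
    have := hy j
    positivity
  · rw [polyEnsembleDensity_of_not_injective _ _ hinj]

theorem lintegral_columnKernel_mul_polyEnsembleDensity (hc : 0 < c)
    (hf : ∀ i, IntegrableOn (f i) (Set.Ioi 0))
    (hpos : ∀ t : Fin n → ℝ, (∀ j, 0 < t j) → 0 ≤ polyEnsembleDensity Z f t)
    (hy : ∀ j, 0 < y j) (hym : StrictMono y) :
    ∫⁻ x in {x : Fin n → ℝ | y ∈ interlacingSet (Fin.cons 0 x)},
        ENNReal.ofReal (columnKernel k x y) * ENNReal.ofReal (polyEnsembleDensity Z f x) =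
      ENNReal.ofReal ((n + 1) * polyEnsembleDensity ((n + 1) * k.factorial * Z)
        (columnExtensionFunctions (k + 1) c f) y) := by
  have hbox : MeasurableSet (Set.univ.pi fun j : Fin n => Set.Ioo (y j.castSucc) (y j.succ)) :=
    MeasurableSet.univ_pi fun _ => measurableSet_Ioo
  have hA : 0 ≤ vandermondeProd y * (∏ j, y j ^ k * Real.exp (-y j)) / k.factorial :=
    div_nonneg (mul_nonneg (vandermondeProd_pos hym).le (Finset.prod_nonneg fun j _ => by
      have := hy j
      positivity)) (by positivity)
  rw [polyEnsembleDensity_columnExtension hc hf hy hym, ENNReal.ofReal_mul hA,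
    ofReal_integral_eq_lintegral_ofReal
      ((integrableOn_pi_det (integrableOn_box hf hy)).const_mul Z⁻¹)
      ((ae_restrict_iff' hbox).2 (ae_of_all _ (setIntegral_box_nonneg hpos hy))),
    ← lintegral_const_mul' _ _ ENNReal.ofReal_ne_top, setOf_mem_interlacingSet_cons_zero (hy 0)]
  refine setLIntegral_congr_fun hbox fun x hx => ?_
  rw [← setOf_mem_interlacingSet_cons_zero (hy 0)] at hx
  obtain ⟨h1, h2⟩ := strictMono_of_mem_interlacingSet_cons_zero hx
  rw [← ENNReal.ofReal_mul' (hpos x h2), columnKernel_mul_polyEnsembleDensity Z f y h1,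
    ENNReal.ofReal_mul hA]

end Box

/-! ### Measurability and assembly of the law -/

theorem aemeasurable_polyEnsembleDensity {N : ℕ} {f : Fin N → ℝ → ℝ}
    (hf : ∀ i, AEMeasurable (f i) (volume.restrict (Set.Ioi 0))) (Z : ℝ) :
    AEMeasurable (polyEnsembleDensity Z f) (volume.restrict {t : Fin N → ℝ | ∀ j, 0 < t j}) := by
  have hset : {t : Fin N → ℝ | ∀ j, 0 < t j} = Set.univ.pi fun _ => Set.Ioi 0 := by
    ext; simp
  have hq : ∀ i j, AEMeasurable (fun t : Fin N → ℝ => f i (t j))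
      (volume.restrict {t : Fin N → ℝ | ∀ j, 0 < t j}) := by
    intro i j
    rw [hset, volume_pi, Measure.restrict_pi_pi]
    exact (hf i).comp_quasiMeasurePreserving (Measure.quasiMeasurePreserving_eval _ j)
  unfold polyEnsembleDensity
  simp_rw [det_of_eq_sum_perm]
  refine AEMeasurable.mul (Measurable.aemeasurable ?_) ?_
  · unfold vandermondeProd
    fun_prop
  · exact Finset.aemeasurable_fun_sum _ fun σ _ => AEMeasurable.const_mul
      (Finset.aemeasurable_fun_prod _ fun i _ => hq (σ i) i) _

theorem measurable_sqSingularValues_comp {α : Type*} [MeasurableSpace α] {m n : ℕ}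
    {A : α → Matrix (Fin m) (Fin n) ℂ} (hA : ∀ i j, Measurable fun a => A a i j)
    {F : (Fin n → ℝ) → ℝ≥0∞} (hFm : Measurable F)
    (hF : ∀ (σ : Equiv.Perm (Fin n)) (t : Fin n → ℝ), F (t ∘ σ) = F t) :
    Measurable fun a => F (sqSingularValues (A a)) := by
  refine measurable_symmetric_comp hFm hF fun t _ => ?_
  have h : (fun a => ∏ i, (1 - sqSingularValues (A a) i / t)) =
      fun a => (1 - (t : ℂ)⁻¹ • (A a * (A a)ᴴ)).det.re := by
    ext a
    rw [← prod_one_sub_sqSingularValues, Complex.ofReal_re]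
  rw [h]
  simp only [Matrix.det_apply', Matrix.sub_apply, Matrix.smul_apply, Matrix.mul_apply,
    Matrix.conjTranspose_apply]
  refine Complex.measurable_re.comp ?_
  fun_prop

section Assembly
variable {n k : ℕ}

/-- `∫ F(y) K(x, y) dy` over the `y` interlacing with `0, x_1, …, x_n`. -/
noncomputable def columnTransition (k : ℕ) (F : (Fin (n + 1) → ℝ) → ℝ≥0∞) (x : Fin n → ℝ) : ℝ≥0∞ :=
  ∫⁻ y, (interlacingSet (Fin.cons 0 x)).indicator
    (fun y => ENNReal.ofReal (columnKernel k x y) * F y) y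

theorem measurable_columnTransition_integrand {F : (Fin (n + 1) → ℝ) → ℝ≥0∞} (hF : Measurable F) :
    Measurable fun p : (Fin n → ℝ) × (Fin (n + 1) → ℝ) =>
      (interlacingSet (Fin.cons 0 p.1)).indicator
        (fun y => ENNReal.ofReal (columnKernel k p.1 y) * F y) p.2 := by
  have hS : MeasurableSet {p : (Fin n → ℝ) × (Fin (n + 1) → ℝ) |
      p.2 ∈ interlacingSet (Fin.cons 0 p.1)} := by
    simp_rw [mem_interlacingSet_cons_zero_iff]
    exact measurableSet_setOfPred.2 (by fun_prop)
  have hK : Measurable fun p : (Fin n → ℝ) × (Fin (n + 1) → ℝ) =>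
      ENNReal.ofReal (columnKernel k p.1 p.2) * F p.2 := by
    unfold columnKernel vandermondeProd
    fun_prop
  exact hK.indicator hS

theorem measurable_columnTransition {F : (Fin (n + 1) → ℝ) → ℝ≥0∞} (hF : Measurable F) :
    Measurable (columnTransition (n := n) k F) :=
  (measurable_columnTransition_integrand hF).lintegral_prod_right'

theorem columnTransition_eq_zero {F : (Fin (n + 1) → ℝ) → ℝ≥0∞} {x : Fin n → ℝ}
    (hx : ¬ StrictMono x) : columnTransition k F x = 0 := by
  unfold columnTransition
  rw [lintegral_eq_zero_of_ae_eq_zero]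
  refine ae_of_all _ fun y => Set.indicator_of_notMem (fun h => ?_) _
  exact hx (strictMono_of_mem_interlacingSet_cons_zero h).1

/-- The symmetrization of `columnTransition`. -/
noncomputable def symmColumnTransition (k : ℕ) (F : (Fin (n + 1) → ℝ) → ℝ≥0∞) (x : Fin n → ℝ) :
    ℝ≥0∞ :=
  ∑ σ : Equiv.Perm (Fin n), columnTransition k F (x ∘ σ)

theorem measurable_symmColumnTransition {F : (Fin (n + 1) → ℝ) → ℝ≥0∞} (hF : Measurable F) :
    Measurable (symmColumnTransition (n := n) k F) :=
  Finset.measurable_fun_sum _ fun σ _ => (measurable_columnTransition hF).comp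
    (measurable_pi_iff.2 fun i => measurable_pi_apply (σ i))

theorem symmColumnTransition_comp_perm {F : (Fin (n + 1) → ℝ) → ℝ≥0∞} (σ : Equiv.Perm (Fin n))
    (x : Fin n → ℝ) : symmColumnTransition k F (x ∘ σ) = symmColumnTransition k F x :=
  Equiv.sum_comp (Equiv.mulLeft σ) fun τ => columnTransition k F (x ∘ τ)

theorem symmColumnTransition_of_injective {F : (Fin (n + 1) → ℝ) → ℝ≥0∞} {x : Fin n → ℝ}
    (hx : Function.Injective x) :
    symmColumnTransition k F x = columnTransition k F (x ∘ Tuple.sort x) := by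
  rw [← sum_indicator_strictMono_comp hx (columnTransition k F)]
  refine Finset.sum_congr rfl fun σ _ => ?_
  by_cases h : StrictMono (x ∘ σ)
  · exact (Set.indicator_of_mem (show x ∘ σ ∈ {t | StrictMono t} from h) _).symm
  · rw [Set.indicator_of_notMem (show x ∘ σ ∉ {t | StrictMono t} from h),
      columnTransition_eq_zero h]

variable {Ω : Type*} [MeasurableSpace Ω] {μ : Measure Ω}

/-- The event of a nonpositive or repeated point is symmetric, so the density identity applies to
its indicator; the Vandermonde factor vanishes at repeated points. -/
theorem IsPolynomialEnsemble.ae_pos_injective {X : Ω → Matrix (Fin (n + (k + 1))) (Fin n) ℂ}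
    (hX : Measurable X) {f : Fin n → ℝ → ℝ}
    (hf : IsPolynomialEnsemble μ (fun ω => sqSingularValues (X ω)) f) :
    ∀ᵐ ω ∂μ, (∀ j, 0 < sqSingularValues (X ω) j) ∧ Function.Injective (sqSingularValues (X ω)) := by
  obtain ⟨Z, _, _, hint⟩ := hf.exists_density
  let s : Set (Fin n → ℝ) := {t | (∀ j, 0 < t j) ∧ ∀ i j, i ≠ j → t i ≠ t j}
  have hs : MeasurableSet s := measurableSet_setOfPred.2 (by fun_prop)
  have hFm : Measurable (sᶜ.indicator (1 : (Fin n → ℝ) → ℝ≥0∞)) := measurable_one.indicator hs.compl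
  have hF : ∀ (σ : Equiv.Perm (Fin n)) (t : Fin n → ℝ),
      sᶜ.indicator (1 : (Fin n → ℝ) → ℝ≥0∞) (t ∘ σ) = sᶜ.indicator 1 t := by
    intro σ t
    have : t ∘ σ ∈ s ↔ t ∈ s := by
      refine and_congr ⟨fun h j => ?_, fun h j => h _⟩ ⟨fun h i j hij => ?_, fun h i j hij => ?_⟩
      · simpa using h (σ.symm j)
      · simpa using h (σ.symm i) (σ.symm j) (by simpa using hij)
      · exact h _ _ (by simpa using hij)
    simp [Set.indicator_apply, this]
  have h := hint _ hFm hF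
  have h0 : ∫⁻ t in {t : Fin n → ℝ | ∀ j, 0 < t j},
      sᶜ.indicator (1 : (Fin n → ℝ) → ℝ≥0∞) t * ENNReal.ofReal (polyEnsembleDensity Z f t) = 0 := by
    rw [setLIntegral_congr_fun (g := fun _ => 0) (measurableSet_forall_pos n), lintegral_zero]
    intro t ht
    by_cases hts : t ∈ s
    · simp [hts]
    · have : ¬ Function.Injective t := fun hinj => hts ⟨ht, fun i j hij => hinj.ne hij⟩
      simp [polyEnsembleDensity_of_not_injective Z f this]
  have hm : Measurable fun ω => sᶜ.indicator (1 : (Fin n → ℝ) → ℝ≥0∞) (sqSingularValues (X ω)) :=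
    measurable_sqSingularValues_comp (A := X)
      (fun i j => (measurable_pi_apply j).comp ((measurable_pi_apply i).comp hX)) hFm hF
  rw [h0, lintegral_eq_zero_iff hm] at h
  filter_upwards [h] with ω hω
  have hmem : sqSingularValues (X ω) ∈ s := by
    by_contra hn
    simp [hn] at hω
  exact ⟨hmem.1, fun i j hij => by
    by_contra hne
    exact hmem.2 i j hne hij⟩

/-- Independence and Tonelli reduce this to a fixed matrix with simple positive spectrum; only the
sorting permutation then contributes to the symmetrized kernel. -/
theorem lintegral_symmColumnTransition_sqSingularValues [IsProbabilityMeasure μ]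
    {X : Ω → Matrix (Fin (n + (k + 1))) (Fin n) ℂ} (hX : Measurable X)
    (hsimple : ∀ᵐ ω ∂μ, (∀ j, 0 < sqSingularValues (X ω) j) ∧
      Function.Injective (sqSingularValues (X ω)))
    {v : Ω → Fin (n + (k + 1)) → ℂ} (hv : IsComplexGaussianVector μ v) (hXv : IndepFun X v μ)
    {F : (Fin (n + 1) → ℝ) → ℝ≥0∞} (hFm : Measurable F)
    (hF : ∀ (σ : Equiv.Perm (Fin (n + 1))) (t : Fin (n + 1) → ℝ), F (t ∘ σ) = F t) :
    ∫⁻ ω, F (sqSingularValues (appendCol (X ω) (v ω))) ∂μ =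
      ∫⁻ ω, symmColumnTransition k F (sqSingularValues (X ω)) ∂μ := by
  have hY : Measurable fun p : Matrix (Fin (n + (k + 1))) (Fin n) ℂ × (Fin (n + (k + 1)) → ℂ) =>
      F (sqSingularValues (appendCol p.1 p.2)) := by
    refine measurable_sqSingularValues_comp (fun i j => ?_) hFm hF
    refine Fin.lastCases ?_ (fun j => ?_) j
    · simp only [appendCol, Matrix.of_apply, Fin.snoc_last]
      exact (measurable_pi_apply i).comp measurable_snd
    · simp only [appendCol, Matrix.of_apply, Fin.snoc_castSucc]
      exact (measurable_pi_apply j).comp ((measurable_pi_apply i).comp measurable_fst)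
  have hprod := (indepFun_iff_map_prod_eq_prod_map_map hX.aemeasurable
    hv.measurable.aemeasurable).1 hXv
  rw [hv.map_eq_pi] at hprod
  calc _ = ∫⁻ p, F (sqSingularValues (appendCol p.1 p.2)) ∂μ.map fun ω => (X ω, v ω) :=
        (lintegral_map hY (hX.prodMk hv.measurable)).symm
    _ = ∫⁻ A, ∫⁻ w, F (sqSingularValues (appendCol A w)) ∂(Measure.pi fun _ => complexGaussian)
          ∂μ.map X := by
        rw [hprod, lintegral_prod _ hY.aemeasurable]
    _ = ∫⁻ ω, ∫⁻ w, F (sqSingularValues (appendCol (X ω) w)) ∂(Measure.pi fun _ => complexGaussian)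
          ∂μ := lintegral_map hY.lintegral_prod_right' hX
    _ = _ := by
        refine lintegral_congr_ae ?_
        filter_upwards [hsimple] with ω hω
        rw [symmColumnTransition_of_injective hω.2, columnTransition,
          lintegral_indicator (measurableSet_interlacingSet _)]
        exact lintegral_sqSingularValues_appendCol (X ω) (Tuple.sort _)
          ((Tuple.monotone_sort _).strictMono_of_injective (hω.2.comp (Tuple.sort _).injective))
          hω.1 hFm hF

/-- The kernel lives on sorted pairs, so unfolding the symmetrization gives `n!` on the `x` side and
`(n + 1)!` on the `y` side. Tonelli and the box integral, which carries the factor `n + 1`, match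
the two. -/
theorem lintegral_symmColumnTransition_mul_density {Z c : ℝ} {f : Fin n → ℝ → ℝ} (hc : 0 < c)
    (hf : ∀ i, IntegrableOn (f i) (Set.Ioi 0))
    (hg : ∀ i, IntegrableOn (columnExtensionFunctions (k + 1) c f i) (Set.Ioi 0))
    (hpos : ∀ t : Fin n → ℝ, (∀ j, 0 < t j) → 0 ≤ polyEnsembleDensity Z f t)
    {F : (Fin (n + 1) → ℝ) → ℝ≥0∞} (hFm : Measurable F)
    (hF : ∀ (σ : Equiv.Perm (Fin (n + 1))) (t : Fin (n + 1) → ℝ), F (t ∘ σ) = F t) :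
    ∫⁻ x in {x : Fin n → ℝ | ∀ j, 0 < x j},
        symmColumnTransition k F x * ENNReal.ofReal (polyEnsembleDensity Z f x) =
      ∫⁻ y in {y : Fin (n + 1) → ℝ | ∀ j, 0 < y j}, F y * ENNReal.ofReal
        (polyEnsembleDensity ((n + 1) * k.factorial * Z) (columnExtensionFunctions (k + 1) c f) y) := by
  set g := columnExtensionFunctions (k + 1) c f
  set Z' := (n + 1) * k.factorial * Z
  have hp : AEMeasurable (fun x => ENNReal.ofReal (polyEnsembleDensity Z f x))
      (volume.restrict {x : Fin n → ℝ | ∀ j, 0 < x j}) :=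
    (aemeasurable_polyEnsembleDensity (fun i => (hf i).aemeasurable) Z).ennreal_ofReal
  have hq : AEMeasurable (fun y => ENNReal.ofReal (polyEnsembleDensity Z' g y))
      (volume.restrict {y : Fin (n + 1) → ℝ | ∀ j, 0 < y j}) :=
    (aemeasurable_polyEnsembleDensity (fun i => (hg i).aemeasurable) Z').ennreal_ofReal
  have hleft : ∫⁻ x in {x : Fin n → ℝ | ∀ j, 0 < x j},
      symmColumnTransition k F x * ENNReal.ofReal (polyEnsembleDensity Z f x) =
      n.factorial * ∫⁻ x in {x : Fin n → ℝ | ∀ j, 0 < x j},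
        columnTransition k F x * ENNReal.ofReal (polyEnsembleDensity Z f x) := by
    rw [← lintegral_pos_sum_perm
      (φ := fun x => columnTransition k F x * ENNReal.ofReal (polyEnsembleDensity Z f x))
      ((measurable_columnTransition hFm).aemeasurable.mul hp)]
    refine lintegral_congr fun x => ?_
    simp_rw [polyEnsembleDensity_comp_perm, ← Finset.sum_mul]
    rfl
  have hright : ∫⁻ y in {y : Fin (n + 1) → ℝ | ∀ j, 0 < y j},
      F y * ENNReal.ofReal (polyEnsembleDensity Z' g y) =
      (n + 1).factorial * ∫⁻ y in {y : Fin (n + 1) → ℝ | ∀ j, 0 < y j},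
        {y : Fin (n + 1) → ℝ | StrictMono y}.indicator
          (fun y => F y * ENNReal.ofReal (polyEnsembleDensity Z' g y)) y := by
    rw [← lintegral_pos_sum_perm
      (φ := {y : Fin (n + 1) → ℝ | StrictMono y}.indicator
        fun y => F y * ENNReal.ofReal (polyEnsembleDensity Z' g y))
      ((hFm.aemeasurable.mul hq).indicator (measurableSet_strictMono _))]
    refine lintegral_congr fun y => ?_
    by_cases hy : Function.Injective y
    · rw [sum_indicator_strictMono_comp hy, hF, polyEnsembleDensity_comp_perm]
    · rw [polyEnsembleDensity_of_not_injective _ _ hy, ENNReal.ofReal_zero, mul_zero,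
        Finset.sum_eq_zero]
      intro σ _
      refine Set.indicator_of_notMem (fun h : StrictMono (y ∘ σ) => hy ?_) _
      exact (σ.injective_comp y).1 h.injective
  have hinner : ∀ y : Fin (n + 1) → ℝ, ∫⁻ x in {x : Fin n → ℝ | ∀ j, 0 < x j},
      (interlacingSet (Fin.cons 0 x)).indicator
        (fun y => ENNReal.ofReal (columnKernel k x y) * F y) y *
          ENNReal.ofReal (polyEnsembleDensity Z f x) =
      {y : Fin (n + 1) → ℝ | ∀ j, 0 < y j}.indicator ({y : Fin (n + 1) → ℝ | StrictMono y}.indicator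
        fun y => (n + 1) * (F y * ENNReal.ofReal (polyEnsembleDensity Z' g y))) y := by
    intro y
    by_cases hy : (∀ j, 0 < y j) ∧ StrictMono y
    · rw [Set.indicator_of_mem (show y ∈ {y : Fin (n + 1) → ℝ | ∀ j, 0 < y j} from hy.1),
        Set.indicator_of_mem (show y ∈ {y : Fin (n + 1) → ℝ | StrictMono y} from hy.2)]
      have hS : MeasurableSet {x : Fin n → ℝ | y ∈ interlacingSet (Fin.cons 0 x)} := by
        rw [setOf_mem_interlacingSet_cons_zero (hy.1 0)]
        exact MeasurableSet.univ_pi fun _ => measurableSet_Ioo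
      have hSpos : {x : Fin n → ℝ | y ∈ interlacingSet (Fin.cons 0 x)} ⊆
          {x : Fin n → ℝ | ∀ j, 0 < x j} :=
        fun x hx => (strictMono_of_mem_interlacingSet_cons_zero hx).2
      have hKp : AEMeasurable (fun x => ENNReal.ofReal (columnKernel k x y) *
          ENNReal.ofReal (polyEnsembleDensity Z f x))
          (volume.restrict {x : Fin n → ℝ | y ∈ interlacingSet (Fin.cons 0 x)}) := by
        refine AEMeasurable.mul ?_ (hp.mono_set hSpos)
        refine Measurable.aemeasurable ?_
        unfold columnKernel vandermondeProd
        fun_prop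
      calc _ = ∫⁻ x in {x : Fin n → ℝ | ∀ j, 0 < x j},
            {x : Fin n → ℝ | y ∈ interlacingSet (Fin.cons 0 x)}.indicator (fun x => F y *
              (ENNReal.ofReal (columnKernel k x y) * ENNReal.ofReal (polyEnsembleDensity Z f x)))
              x := by
            refine lintegral_congr fun x => ?_
            by_cases hx : y ∈ interlacingSet (Fin.cons 0 x)
            · rw [Set.indicator_of_mem hx, Set.indicator_of_mem (by exact hx), mul_comm _ (F y),
                mul_assoc]
            · rw [Set.indicator_of_notMem hx, Set.indicator_of_notMem (by exact hx), zero_mul]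
        _ = F y * ∫⁻ x in {x : Fin n → ℝ | y ∈ interlacingSet (Fin.cons 0 x)},
              ENNReal.ofReal (columnKernel k x y) * ENNReal.ofReal (polyEnsembleDensity Z f x) := by
            rw [setLIntegral_indicator hS, Set.inter_eq_left.2 hSpos, lintegral_const_mul'' _ hKp]
        _ = _ := by
            rw [lintegral_columnKernel_mul_polyEnsembleDensity hc hf hpos hy.1 hy.2,
              ENNReal.ofReal_mul (by positivity), mul_left_comm,
              show ENNReal.ofReal ((n : ℝ) + 1) = (n : ℝ≥0∞) + 1 by
                exact_mod_cast ENNReal.ofReal_natCast (n + 1)]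
    · have hempty : ∀ x : Fin n → ℝ, y ∉ interlacingSet (Fin.cons 0 x) := fun x hx => by
        have hm := strictMono_of_mem_interlacingSet hx
        exact hy ⟨fun j => ((mem_interlacingSet_cons_zero_iff.1 hx).1).trans_le
          (hm.monotone (Fin.zero_le j)), hm⟩
      simp only [Set.indicator_of_notMem (hempty _), zero_mul, lintegral_zero]
      rw [Set.indicator_indicator, Set.indicator_of_notMem]
      exact fun h => hy ⟨h.1, h.2⟩
  rw [hleft, hright]
  calc _ = (n.factorial : ℝ≥0∞) * ∫⁻ x in {x : Fin n → ℝ | ∀ j, 0 < x j}, ∫⁻ y,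
        (interlacingSet (Fin.cons 0 x)).indicator
          (fun y => ENNReal.ofReal (columnKernel k x y) * F y) y *
            ENNReal.ofReal (polyEnsembleDensity Z f x) := by
        congr 1
        refine lintegral_congr fun x => ?_
        rw [columnTransition, lintegral_mul_const' _ _ ENNReal.ofReal_ne_top]
    _ = (n.factorial : ℝ≥0∞) * ∫⁻ y, ∫⁻ x in {x : Fin n → ℝ | ∀ j, 0 < x j},
        (interlacingSet (Fin.cons 0 x)).indicator
          (fun y => ENNReal.ofReal (columnKernel k x y) * F y) y *
            ENNReal.ofReal (polyEnsembleDensity Z f x) := by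
        congr 1
        refine lintegral_lintegral_swap ?_
        exact (measurable_columnTransition_integrand hFm).aemeasurable.mul hp.comp_fst
    _ = _ := by
        simp_rw [hinner]
        rw [lintegral_indicator (measurableSet_forall_pos (n + 1)), Nat.factorial_succ,
          Nat.cast_mul, mul_comm ((n + 1 : ℕ) : ℝ≥0∞), mul_assoc]
        congr 1
        rw [← lintegral_const_mul' _ _ (ENNReal.natCast_ne_top (n + 1))]
        refine lintegral_congr fun y => ?_
        by_cases hy : StrictMono y
        · simp [hy]
        · simp [hy]

end Assembly

theorem integrableOn_columnExtensionFunctions_moments {n k : ℕ} (hn : 1 ≤ n) {c : ℝ} (hc : 0 < c)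
    {f : Fin n → ℝ → ℝ}
    (hf : ∀ j i : Fin n, IntegrableOn (fun t : ℝ => t ^ (j : ℕ) * f i t) (Set.Ioi 0))
    (j i : Fin (n + 1)) :
    IntegrableOn (fun t => t ^ (j : ℕ) * columnExtensionFunctions (k + 1) c f i t) (Set.Ioi 0) := by
  refine Fin.cases ?_ (fun i => ?_) i
  · refine (integrableOn_pow_mul_exp_neg (j + k)).congr_fun (fun t _ => ?_) measurableSet_Ioi
    simp [columnExtensionFunctions, pow_add, mul_assoc]
  · have h0 : IntegrableOn (f i) (Set.Ioi 0) := by simpa using hf ⟨0, hn⟩ i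
    -- Moments of `f i` are given only up to degree `n - 1`; the new top degree `j = n` uses `p = n
    -- - 1` and the gained power.
    have hp : min (j : ℕ) (n - 1) < n := by omega
    have hjp : (j : ℕ) = min (j : ℕ) (n - 1) ∨ (j : ℕ) = min (j : ℕ) (n - 1) + 1 := by omega
    exact integrableOn_pow_mul_columnExtension hc hjp h0 (hf ⟨_, hp⟩ i)

theorem corollary5p4 {Ω : Type*} [MeasurableSpace Ω] (μ : Measure Ω) [IsProbabilityMeasure μ]
    (n ν : ℕ) (hn : 1 ≤ n) (hν : 1 ≤ ν)
    (X : Ω → Matrix (Fin (n + ν)) (Fin n) ℂ) (hX : Measurable X)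
    (f : Fin n → ℝ → ℝ)
    (hf : IsPolynomialEnsemble μ (fun ω => sqSingularValues (X ω)) f)
    (v : Ω → Fin (n + ν) → ℂ) (hv : IsComplexGaussianVector μ v)
    (hXv : IndepFun X v μ)
    (c : ℝ) (hc : 0 < c) :
    IsPolynomialEnsemble μ (fun ω => sqSingularValues (appendCol (X ω) (v ω)))
      (columnExtensionFunctions ν c f) := by
  obtain ⟨k, rfl⟩ : ∃ k, ν = k + 1 := ⟨ν - 1, by omega⟩
  have hmom := integrableOn_columnExtensionFunctions_moments (k := k) hn hc hf.integrable_moments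
  have hf0 : ∀ i, IntegrableOn (f i) (Set.Ioi 0) := fun i => by
    simpa using hf.integrable_moments ⟨0, hn⟩ i
  have hg0 : ∀ i, IntegrableOn (columnExtensionFunctions (k + 1) c f i) (Set.Ioi 0) := fun i => by
    simpa using hmom 0 i
  obtain ⟨Z, hZ, hpos, hint⟩ := hf.exists_density
  refine ⟨hmom, (n + 1) * k.factorial * Z, ?_,
    fun t ht => polyEnsembleDensity_columnExtension_nonneg hc hf0 hpos ht, fun F hFm hF => ?_⟩
  · exact mul_ne_zero (by positivity) hZ
  · rw [lintegral_symmColumnTransition_sqSingularValues hX (hf.ae_pos_injective hX) hv hXv hFm hF,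
      hint _ (measurable_symmColumnTransition hFm) symmColumnTransition_comp_perm,
      lintegral_symmColumnTransition_mul_density hc hf0 hg0 hpos hFm hF]
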